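/- Let $p$ be a prime, let $G$ be a finite $p$-group and let $R$ be a profinite commutative ring that is local and noetherian. A profinite $RG$-module is a profinite $R$-module with a continuous $R$-linear action of $G$. A profinite $R$-module $U$ is free with profinite $R$-basis $B\subseteq U$ if $0\notin B$, the set $B\cup\{0\}$ is closed in $U$, and every continuous map $\varphi\colon B\cup\{0\}\to N$ to a profinite $R$-module $N$ with $\varphi(0)=0$ extends uniquely to a continuous $R$-linear map $U\to N$. (If $B$ itself is closed, this says that $U$ is the free profinite $R$-module on the profinite space $B$; bases converging to $0$ are also included.) A profinite permutation $RG$-lattice is a profinite $RG$-module that is free as a profinite $R$-module and has a profinite $R$-basis $B$ with $gB\subseteq B$ for all $g\in G$. Let $U$ be a profinite permutation $RG$-lattice. Then $U$ is a cartesian product of cyclic permutation modules: there are cardinal numbers $\kappa_H$, one for each subgroup $H\leq G$, and an isomorphism of profinite $RG$-modules (an $R$-linear, $G$-equivariant homeomorphism) $$U\;\cong\;\prod_{H\leq G}\ \prod_{\kappa_H} R[G/H],$$ where $R[G/H]$ is the free $R$-module on the finite set $G/H$ of left cosets with $G$ permuting the cosets, each $R[G/H]$ and the product carry the product topology, and $\prod_{\kappa_H}$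 is a product of $\kappa_H$ copies. -/

import Mathlib

universe u v

/-- `IsProfiniteBasis R B`: the profinite `R`-module `U` is a free profinite `R`-module with
profinite basis `B ⊆ U`.  The topology of the basis is the one of `U`; the subspace `B ∪ {0}` is
closed in `U` (hence a profinite space), and every continuous map from `B ∪ {0}` to a profinite
`R`-module `N` that sends `0` to `0` extends uniquely to a continuous `R`-linear map `U → N`.

If `B` itself is closed, then `0` is an isolated point of `B ∪ {0}`, and this is the universal
property of the free profinite module on the profinite space `B`.  In general it is the universal
property of the free profinite module on the pointed profinite space `(B ∪ {0}, 0)`; this includes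
bases `B` that are discrete and converge to `0`. -/
structure IsProfiniteBasis (R : Type u) [CommRing R] [TopologicalSpace R]
    {U : Type v} [AddCommGroup U] [Module R U] [TopologicalSpace U] (B : Set U) : Prop where
  zero_notMem : (0 : U) ∉ B
  isClosed_insert : IsClosed (insert 0 B)
  existsUnique_extension :
    ∀ (N : Type (max u v)) [AddCommGroup N] [Module R N] [TopologicalSpace N]
      [IsTopologicalAddGroup N] [ContinuousSMul R N] [CompactSpace N] [T2Space N]
      [TotallyDisconnectedSpace N] (φ : U → N),
      ContinuousOn φ (insert 0 B) → φ 0 = 0 → ∃! f : U →L[R] N, ∀ b ∈ B, f b = φ b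

/-- A profinite `RG`-module `U` (a profinite `R`-module with a commuting continuous `R`-linear
action of `G`) is a profinite permutation `RG`-lattice if it is free as a profinite `R`-module,
with a profinite `R`-basis that is left invariant by the action of `G`. -/
def IsProfinitePermutationLattice (R : Type u) (G : Type*) (U : Type v)
    [CommRing R] [TopologicalSpace R] [Group G]
    [AddCommGroup U] [Module R U] [TopologicalSpace U] [DistribMulAction G U] : Prop :=
  ∃ B : Set U, IsProfiniteBasis R B ∧ ∀ (g : G), ∀ b ∈ B, g • b ∈ B

/-- The cyclic permutation module `R[G/H]` of a finite group `G`.  The formal sum `∑ x, f x • x` over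
the (finitely many) left cosets `x` of `H` is encoded by its coefficient function `f`, and the
topology is the product topology. -/
def CyclicPermutationModule (R : Type*) {G : Type*} [Group G] (H : Subgroup G) : Type _ :=
  G ⧸ H → R

namespace CyclicPermutationModule

variable {R : Type*} {G : Type*} [Group G] {H : Subgroup G}

instance [CommRing R] : AddCommGroup (CyclicPermutationModule R H) :=
  inferInstanceAs (AddCommGroup (G ⧸ H → R))

instance [CommRing R] : Module R (CyclicPermutationModule R H) :=
  inferInstanceAs (Module R (G ⧸ H → R))

instance [TopologicalSpace R] : TopologicalSpace (CyclicPermutationModule R H) :=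
  inferInstanceAs (TopologicalSpace (G ⧸ H → R))

/-- `G` permutes the cosets: `g • ∑ x, f x • x = ∑ x, f x • (g • x) = ∑ x, f (g⁻¹ • x) • x`. -/
instance [CommRing R] : DistribMulAction G (CyclicPermutationModule R H) where
  smul g f := fun x => f (g⁻¹ • x)
  one_smul f := by
    funext x
    change f ((1 : G)⁻¹ • x) = f x
    rw [inv_one, one_smul]
  mul_smul a b f := by
    funext x
    change f ((a * b)⁻¹ • x) = f (b⁻¹ • a⁻¹ • x)
    rw [mul_inv_rev, mul_smul]
  smul_zero _ := rfl
  smul_add _ _ _ := rfl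

end CyclicPermutationModule

/-! Put `X = insert 0 B`, a pointed profinite `G`-space, and let `k` be the residue field of `R`,
which is finite. Continuous functionals `U → R` are the continuous functions on `X` vanishing at
`0`. By Nakayama and compactness, functionals whose reductions form a `k`-basis of the locally
constant functions `X → k` vanishing at `0` are coordinates identifying `U` with a power of `R`
(`IsProfiniteBasis.bijective_of_residue_basis`). So it suffices to find a `k`-basis permuted by `G`
(`IsPGroup.hasPermBasis`): orbit representatives lift to functionals with the same invariance, and
an orbit of type `G/H` contributes a factor `R[G/H]`.

The permuted basis is found by induction on the number of stabilizers occurring off the base point.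
A stabilizer `H` of least order defines an open stratum `Y`, the points with stabilizer conjugate to
`H`. Functions on the closed complement of `Y` extend to `X` with their invariance preserved, so
bases on `Y` and on the complement combine (`IsPermFamily.sum_elim`). On `Y`, every invariant clopen
subset has a clopen transversal (`IsStratum.exists_isTransversal`), although `Y` itself need not be
compact. Two cases remain.

If `p = 0` in `k`, indicators of suitable transversals generate a basis. Both independence and
spanning reduce to invariants, because a `p`-group fixes a nonzero vector in each nonzero
representation.

If `p ≠ 0` in `k`, Maschke's theorem makes everything semisimple. An infinite function space on `Y`
is then a direct sum of copies of `k[G/H]` by counting homomorphisms and a Schröder–Bernstein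
argument; a finite one forces `Y` to be clopen. -/

/-! ### Cardinal arithmetic. -/

section Embeddings

open Cardinal

universe w

theorem nonempty_embedding_of_finite_pi {V Y : Type*} [Finite V] [Infinite Y] :
    Nonempty ((V → Y) ↪ Y) := by
  rw [← lift_mk_le', mk_arrow, lift_power, lift_lift, lift_lift]
  refine (pow_le (by simp) (by simp)).trans ?_
  simp

theorem nonempty_embedding_finsupp {S P : Type*} [Zero P] [Finite P] [Nontrivial P] [Infinite S] :
    Nonempty ((S →₀ P) ↪ S) := by
  rw [← lift_mk_le', mk_finsupp_lift_of_infinite]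
  simpa using (lift_lt_aleph0.2 (lt_aleph0_of_finite P)).le.trans
    (aleph0_le_lift.2 (aleph0_le_mk S))

theorem nonempty_embedding_prod {Y : Type v} {Z : Type w} [Infinite Y] [Finite Z] :
    Nonempty (Y × Z ↪ Y) := by
  rw [← lift_mk_le', mk_prod, lift_mul, lift_lift, lift_lift]
  refine (mul_le_max_of_aleph0_le_left (by simp)).trans (max_le (by simp) ?_)
  exact (lift_lt_aleph0.2 (lt_aleph0_of_finite Z)).le.trans
    (aleph0_le_lift.2 (aleph0_le_mk Y))

end Embeddings

/-! ### Semisimple modules: Schröder–Bernstein and direct sums of copies of a finite module. -/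

section SemisimpleModules

variable {A : Type*} [Ring A]

/-- A Schröder–Bernstein theorem for semisimple modules. -/
theorem IsSemisimpleModule.nonempty_linearEquiv_of_injective {M N : Type*} [AddCommGroup M]
    [AddCommGroup N] [Module A M] [Module A N] [IsSemisimpleModule A M]
    [IsSemisimpleModule A N] (i : M →ₗ[A] N) (j : N →ₗ[A] M)
    (hi : Function.Injective i) (hj : Function.Injective j) :
    Nonempty (M ≃ₗ[A] N) := by
  obtain ⟨C, hC⟩ := exists_isCompl (LinearMap.range j)
  set f : M →ₗ[A] M := j ∘ₗ i
  have hfi : Function.Injective f := hj.comp hi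
  have hfr : LinearMap.range f ≤ LinearMap.range j := LinearMap.range_comp_le_range i j
  -- The Cantor–Bernstein set in linear form: `D` is the least solution of `D = C + f D`, that is,
  -- `C + f C + f² C + ⋯`. With `E` a complement of `j⁻¹(f D)` in `N`, one gets `M = D ⊕ j E` and `N
  -- = j⁻¹(f D) ⊕ E`, both isomorphic to `D ⊕ E`.
  set D : Submodule A M := sInf {D | C ⊔ D.map f ≤ D}
  have hD1 : C ⊔ D.map f ≤ D := by
    refine le_sInf fun E hE => le_trans (sup_le_sup_left (Submodule.map_mono ?_) _) hE
    exact sInf_le hE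
  have hD2 : D ≤ C ⊔ D.map f := by
    refine sInf_le ?_
    change C ⊔ (C ⊔ D.map f).map f ≤ C ⊔ D.map f
    exact sup_le_sup_left (Submodule.map_mono hD1) _
  have hDj : D.map f ≤ LinearMap.range j := LinearMap.map_le_range.trans hfr
  obtain ⟨E, hE⟩ := exists_isCompl ((D.map f).comap j)
  have hmap : ((D.map f).comap j).map j = D.map f := by
    rw [Submodule.map_comap_eq, inf_eq_right.2 hDj]
  have hsup : D ⊔ E.map j = ⊤ := by
    have h1 : D.map f ⊔ E.map j = LinearMap.range j := by
      rw [← hmap, ← Submodule.map_sup, hE.sup_eq_top, Submodule.map_top]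
    rw [eq_top_iff, ← hC.sup_eq_top, ← h1]
    refine sup_le (sup_le (le_sup_of_le_left (le_sup_right.trans hD1)) le_sup_right)
      (le_sup_of_le_left (le_sup_left.trans hD1))
  have hinf : Disjoint D (E.map j) := by
    rw [Submodule.disjoint_def]
    rintro _ hx ⟨e, he, rfl⟩
    obtain ⟨c, hc, d, hd, hcd⟩ := Submodule.mem_sup.1 (hD2 hx)
    have hcr : c ∈ LinearMap.range j := by
      rw [eq_sub_of_add_eq hcd]
      exact sub_mem ⟨e, rfl⟩ (hDj hd)
    have hc0 : c = 0 := (Submodule.disjoint_def.1 hC.disjoint) c hcr hc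
    rw [hc0, zero_add] at hcd
    have : e ∈ (D.map f).comap j := by
      rw [Submodule.mem_comap, ← hcd]; exact hd
    rw [(Submodule.disjoint_def.1 hE.disjoint) e this he, map_zero]
  have e1 := Submodule.prodEquivOfIsCompl D (E.map j) ⟨hinf, codisjoint_iff.2 hsup⟩
  have e2 := Submodule.prodEquivOfIsCompl _ E hE
  have e3 : D ≃ₗ[A] (D.map f) := Submodule.equivMapOfInjective f hfi D
  have e4 : (D.map f).comap j ≃ₗ[A] (D.map f) :=
    (Submodule.equivMapOfInjective j hj _).trans (LinearEquiv.ofEq _ _ hmap)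
  have e5 : E ≃ₗ[A] E.map j := Submodule.equivMapOfInjective j hj E
  exact ⟨e1.symm.trans (((e3.trans e4.symm).prodCongr e5.symm).trans e2)⟩

/-- A finite semisimple module embeds in any module receiving infinitely many homomorphisms from
each of its simple submodules. -/
theorem IsSemisimpleModule.exists_injective_of_infinite_hom {P L : Type*} [AddCommGroup P]
    [AddCommGroup L] [Module A P] [Module A L] [IsSemisimpleModule A P] [Finite P]
    (h : ∀ V : Submodule A P, IsSimpleModule A V → Infinite (V →ₗ[A] L)) :
    ∃ f : P →ₗ[A] L, Function.Injective f := by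
  have key : ∀ J : Submodule A P, ∃ f : J →ₗ[A] L, Function.Injective f := by
    have : Finite (Submodule A P) := Finite.of_injective _ SetLike.coe_injective
    obtain ⟨J, hJ, hmax⟩ := (Set.toFinite {J : Submodule A P | ∃ f : J →ₗ[A] L,
      Function.Injective f}).exists_maximal ⟨⊥, 0, fun _ _ _ => Subsingleton.elim _ _⟩
    obtain ⟨f, hf⟩ := hJ
    have hJt : J = ⊤ := by
      by_contra hne
      obtain ⟨C, hC⟩ := exists_isCompl J
      have hC0 : C ≠ ⊥ := by
        rintro rfl
        exact hne (by simpa using hC.sup_eq_top)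
      obtain ⟨V, hV, hVC⟩ := (IsAtomic.eq_bot_or_exists_atom_le C).resolve_left hC0
      have hVs : IsSimpleModule A V := isSimpleModule_iff_isAtom.2 hV
      have hdisj : Disjoint J V := hC.disjoint.mono_right hVC
      have := h V hVs
      -- The range of `f` is finite, so only finitely many maps from `V` land in it. A map `θ` that
      -- does not is injective with range disjoint from that of `f`, since `V` is simple; hence `f`
      -- extends to `J ⊔ V`.
      obtain ⟨θ, hθ⟩ : ∃ θ : V →ₗ[A] L, ¬ LinearMap.range θ ≤ LinearMap.range f := by
        by_contra! hcon
        have hfin : Finite (LinearMap.range f) := by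
          have := Set.finite_range f
          exact this.to_subtype
        have : Finite (V →ₗ[A] LinearMap.range f) := DFunLike.finite _
        refine not_finite_iff_infinite.2 ‹Infinite (V →ₗ[A] L)› ?_
        refine Finite.of_surjective
          (fun g : V →ₗ[A] LinearMap.range f => (LinearMap.range f).subtype ∘ₗ g) fun θ => ?_
        exact ⟨θ.codRestrict _ fun v => hcon θ ⟨v, rfl⟩, by ext; rfl⟩
      have hθ0 : θ ≠ 0 := by
        rintro rfl
        simp at hθ
      have hθi : Function.Injective θ := (LinearMap.injective_or_eq_zero θ).resolve_right hθ0
      have hrd : Disjoint (LinearMap.range f) (LinearMap.range θ) := by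
        rw [Submodule.disjoint_def]
        rintro _ hx ⟨v, rfl⟩
        by_contra hv
        have hcomap : (LinearMap.range f).comap θ = ⊤ := by
          refine (eq_bot_or_eq_top _).resolve_left fun hb => hv ?_
          have : v ∈ (LinearMap.range f).comap θ := hx
          rw [hb, Submodule.mem_bot] at this
          rw [this, map_zero]
        refine hθ ?_
        rintro _ ⟨w, rfl⟩
        have : w ∈ (LinearMap.range f).comap θ := hcomap ▸ Submodule.mem_top
        exact this
      have hinj : Function.Injective (f.coprod θ) := by
        rw [← LinearMap.ker_eq_bot, LinearMap.ker_coprod_of_disjoint_range f θ hrd,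
          LinearMap.ker_eq_bot.2 hf, LinearMap.ker_eq_bot.2 hθi, Submodule.prod_bot]
      have hinc : Function.Injective (J.subtype.coprod V.subtype) := by
        rw [← LinearMap.ker_eq_bot, LinearMap.ker_coprod_of_disjoint_range _ _ (by simpa using hdisj)]
        simp
      have hrange : LinearMap.range (J.subtype.coprod V.subtype) = J ⊔ V := by
        simp [LinearMap.range_coprod]
      let e := (LinearEquiv.ofInjective _ hinc).trans (LinearEquiv.ofEq _ _ hrange)
      have hle : J ⊔ V ≤ J :=
        hmax ⟨f.coprod θ ∘ₗ e.symm.toLinearMap, hinj.comp e.symm.injective⟩ le_sup_left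
      have : V ≤ ⊥ := hdisj (le_sup_right.trans hle) le_rfl
      exact hV.1 (le_bot_iff.1 this)
    intro K
    exact ⟨f ∘ₗ Submodule.inclusion (hJt ▸ le_top),
      hf.comp (Submodule.inclusion_injective _)⟩
  obtain ⟨f, hf⟩ := key ⊤
  exact ⟨f ∘ₗ (Submodule.topEquiv (R := A) (M := P)).symm.toLinearMap,
    hf.comp (LinearEquiv.injective _)⟩

open Cardinal in
/-- An infinite semisimple module `L` that is generated by images of a finite module `P`, and that
receives at least `#L` homomorphisms from each simple submodule of `P`, is a direct sum of copies
of `P`. -/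
theorem IsSemisimpleModule.exists_linearEquiv_finsupp [IsSemisimpleRing A] {P L : Type*}
    [AddCommGroup P] [AddCommGroup L] [Module A P] [Module A L] [Finite P] [Nontrivial P]
    [Infinite L]
    (hspan : ⨆ f : P →ₗ[A] L, LinearMap.range f = ⊤)
    (hcard : ∀ V : Submodule A P, IsSimpleModule A V → ∃ f : L → (V →ₗ[A] L), f.Injective) :
    ∃ S : Set (P →ₗ[A] L), Nonempty ((S →₀ P) ≃ₗ[A] L) := by
  classical
  let Λ : ((P →ₗ[A] L) →₀ P) →ₗ[A] L := Finsupp.lsum ℕ fun f => f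
  have hΛs : ∀ f p, Λ (Finsupp.single f p) = f p := fun f p => by simp [Λ]
  -- The sets of maps whose copies of `P` are independent in `L`. Coefficients are indexed by all of
  -- `Hom(P, L)`, so that different sets can be compared along a chain.
  let good : Set (Set (P →ₗ[A] L)) :=
    {S | ∀ a : (P →ₗ[A] L) →₀ P, (a.support : Set _) ⊆ S → Λ a = 0 → a = 0}
  obtain ⟨S, hS⟩ : ∃ S, Maximal (· ∈ good) S := by
    refine zorn_subset good fun c hc hchain => ⟨⋃₀ c, ?_, fun s => Set.subset_sUnion_of_mem⟩
    intro a ha h0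
    rcases c.eq_empty_or_nonempty with rfl | hne
    · simpa using ha
    · obtain ⟨s, hs, has⟩ := hchain.directedOn.exists_mem_subset_of_finset_subset_biUnion hne
        (f := id) (by simpa [Set.sUnion_eq_biUnion] using ha)
      exact hc hs a has h0
  set Φ : (S →₀ P) →ₗ[A] L := Finsupp.lsum ℕ fun f => f.1 with hΦ
  have hΦΛ : ∀ b : S →₀ P, Φ b = Λ (b.embDomain (Function.Embedding.subtype _)) := by
    intro b
    simp only [hΦ, Λ, Finsupp.lsum_apply, Finsupp.sum_embDomain]
    rfl
  have hΦi : Function.Injective Φ := by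
    rw [injective_iff_map_eq_zero]
    intro b hb
    rw [hΦΛ] at hb
    have := hS.prop _ (by simp) hb
    simpa using this
  obtain ⟨C, hC⟩ := exists_isCompl (LinearMap.range Φ)
  have hno : ¬ ∃ f : P →ₗ[A] C, Function.Injective f := by
    rintro ⟨f, hf⟩
    set θ : P →ₗ[A] L := C.subtype ∘ₗ f
    have hθS : θ ∉ S := by
      intro hmem
      obtain ⟨p, hp⟩ := exists_ne (0 : P)
      have h1 : θ p ∈ LinearMap.range Φ := ⟨Finsupp.single ⟨θ, hmem⟩ p, by simp [hΦ]⟩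
      have h2 := Submodule.disjoint_def.1 hC.disjoint _ h1 (f p).2
      exact hp (hf (by rw [map_zero]; exact Subtype.ext h2))
    refine hθS (hS.2 (y := insert θ S) ?_ (Set.subset_insert _ _) (Set.mem_insert _ _))
    intro a ha h0
    have hdec := Finsupp.single_add_erase θ a
    have hsub : ((a.erase θ).support : Set _) ⊆ S := by
      intro x hx
      simp only [Finsupp.support_erase, Finset.coe_erase, Set.mem_sdiff, Finset.mem_coe,
        Set.mem_singleton_iff] at hx
      exact (ha hx.1).resolve_left hx.2
    have hmem : Λ (a.erase θ) ∈ LinearMap.range Φ := by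
      refine Submodule.sum_mem _ fun g hg => ?_
      exact ⟨Finsupp.single ⟨g, hsub hg⟩ (a.erase θ g), by simp [hΦ]⟩
    rw [← hdec, map_add, hΛs] at h0
    have h1 : θ (a θ) = 0 := by
      refine Submodule.disjoint_def.1 hC.disjoint _ ?_ (f (a θ)).2
      have : θ (a θ) = - Λ (a.erase θ) := eq_neg_of_add_eq_zero_left h0
      change θ (a θ) ∈ _
      rw [this]
      exact neg_mem hmem
    have h2 : a θ = 0 := hf (by rw [map_zero]; exact Subtype.ext h1)
    rw [h1, zero_add] at h0
    rw [← hdec, hS.prop _ hsub h0, h2, Finsupp.single_zero, add_zero]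
  -- By maximality of `S`, no copy of `P` embeds in the complement `C`, so some simple `V` has only
  -- finitely many maps to `C`.
  obtain ⟨V, hV, hfin⟩ : ∃ V : Submodule A P, IsSimpleModule A V ∧ Finite (V →ₗ[A] C) := by
    by_contra! hcon
    exact hno (IsSemisimpleModule.exists_injective_of_infinite_hom fun V hV =>
      not_finite_iff_infinite.1 fun hf => not_finite_iff_infinite.2 (hcon V hV) hf)
  obtain ⟨F, hF⟩ := hcard V hV
  let e := (Submodule.prodEquivOfIsCompl _ C hC).symm
  let e0 := LinearEquiv.ofInjective Φ hΦi
  -- homomorphisms from `V` to `L` are determined by their components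
  let comp : (V →ₗ[A] L) → (V → (S →₀ P)) × (V →ₗ[A] C) := fun g =>
    (fun v => e0.symm (e (g v)).1, LinearMap.snd A _ _ ∘ₗ e.toLinearMap ∘ₗ g)
  have hcomp : Function.Injective comp := by
    intro g g' h
    ext v
    refine e.injective (Prod.ext (e0.symm.injective ?_) ?_)
    · exact congrFun (congrArg Prod.fst h) v
    · exact LinearMap.congr_fun (congrArg Prod.snd h) v
  have hinj := hcomp.comp hF
  have hSinf : Infinite S := by
    by_contra hfin'
    rw [not_infinite_iff_finite] at hfin'
    have : Finite (S →₀ P) := Finite.of_injective _ DFunLike.coe_injective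
    exact not_finite_iff_infinite.2 ‹Infinite L› (Finite.of_injective _ hinj)
  have : Infinite (S →₀ P) := by
    obtain ⟨p, hp⟩ := exists_ne (0 : P)
    exact Infinite.of_injective _ (Finsupp.single_left_injective (M := P) hp)
  obtain ⟨a1⟩ := nonempty_embedding_of_finite_pi (V := V) (Y := S →₀ P)
  obtain ⟨a2⟩ := nonempty_embedding_finsupp (S := S) (P := P)
  obtain ⟨a3⟩ := nonempty_embedding_prod (Y := S →₀ P) (Z := V →ₗ[A] C)
  obtain ⟨a4⟩ := nonempty_embedding_of_finite_pi (V := P) (Y := L)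
  -- `L` embeds in `Hom(V, L)`, hence in a finite power of `S →₀ P` times a finite set; as `S` is
  -- infinite and `P` finite, this has no more elements than `S`.
  have a5 : L ↪ S :=
    (⟨_, hinj⟩ : L ↪ _).trans (((a1.prodMap (Function.Embedding.refl _)).trans a3).trans a2)
  have τ : (P →ₗ[A] L) ↪ S :=
    (⟨_, DFunLike.coe_injective⟩ : (P →ₗ[A] L) ↪ (P → L)).trans (a4.trans a5)
  have hΛsurj : Function.Surjective Λ := by
    rw [← LinearMap.range_eq_top, eq_top_iff, ← hspan]
    refine iSup_le fun f => ?_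
    rintro _ ⟨p, rfl⟩
    exact ⟨_, hΛs f p⟩
  -- Splitting the surjection from the sum over all of `Hom(P, L)` and reindexing along `τ` embeds
  -- `L` in `S →₀ P`; `Φ` is an embedding the other way.
  obtain ⟨σ, hσ⟩ := IsSemisimpleModule.lifting_property Λ hΛsurj LinearMap.id
  have hσi : Function.Injective σ := by
    refine Function.LeftInverse.injective (g := Λ) fun x => ?_
    exact LinearMap.congr_fun hσ x
  exact ⟨S, IsSemisimpleModule.nonempty_linearEquiv_of_injective Φ
    (Finsupp.lmapDomain P A τ ∘ₗ σ) hΦi ((Finsupp.mapDomain_injective τ.injective).comp hσi)⟩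

end SemisimpleModules

/-! ### Fixed vectors of `p`-groups. -/

/-- A representation of a `p`-group over a finite field of characteristic `p` has a nonzero fixed
vector in every nonzero invariant subspace. -/
theorem IsPGroup.exists_fixed_vector {p : ℕ} [Fact p.Prime] {G : Type*} [Group G] [Finite G]
    (hG : IsPGroup p G) {k : Type*} [Field k] [Finite k] (hk : (p : k) = 0) {V : Type*}
    [AddCommGroup V] [Module k V] (ρ : Representation k G V) (N : Submodule k V)
    (hN : ∀ g, ∀ v ∈ N, ρ g v ∈ N) (hN0 : N ≠ ⊥) : ∃ v ∈ N, v ≠ 0 ∧ ∀ g, ρ g v = v := by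
  obtain ⟨v, hv, hv0⟩ := Submodule.exists_mem_ne_zero_of_ne_bot hN0
  -- `V` may be infinite; the span of a single orbit is finite, so its fixed points can be counted
  -- modulo `p`.
  set W : Submodule k V := Submodule.span k (Set.range fun g => ρ g v)
  have hWN : W ≤ N := Submodule.span_le.2 (by rintro _ ⟨g, rfl⟩; exact hN g v hv)
  have hWinv : ∀ g, ∀ w ∈ W, ρ g w ∈ W := by
    intro g w hw
    have : W ≤ W.comap (ρ g) := by
      refine Submodule.span_le.2 ?_
      rintro _ ⟨g', rfl⟩
      refine Submodule.subset_span ⟨g * g', ?_⟩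
      simp
    exact this hw
  have : Module.Finite k W := Module.Finite.span_of_finite k (Set.finite_range _)
  have : Finite W := Module.finite_of_finite k
  let _ : MulAction G W :=
    { smul := fun g w => ⟨ρ g w, hWinv g w w.2⟩
      one_smul := fun w => Subtype.ext (by change ρ 1 (w : V) = w; simp)
      mul_smul := fun g h w => Subtype.ext (by
        change ρ (g * h) (w : V) = ρ g (ρ h w); simp) }
  have hvW : v ∈ W := Submodule.subset_span ⟨1, by simp⟩
  have hdvd : p ∣ Nat.card W := by
    have : p ∣ Nat.card k := by
      have : CharP k p := by
        obtain ⟨q, hq⟩ := CharP.exists k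
        have h1 : q ∣ p := (CharP.cast_eq_zero_iff k q p).1 hk
        have h2 : q ≠ 1 := CharP.char_ne_one k q
        have h3 := (Nat.dvd_prime (Fact.out : p.Prime)).1 h1
        rwa [← h3.resolve_left h2]
      have := Fintype.ofFinite k
      obtain ⟨n, -, hn⟩ := FiniteField.card k p
      rw [Nat.card_eq_fintype_card, hn]
      exact dvd_pow_self p n.ne_zero
    rw [Module.natCard_eq_pow_finrank (K := k)]
    have hnt : Nontrivial W := ⟨⟨v, hvW⟩, 0, fun h => hv0 (congrArg Subtype.val h)⟩
    exact this.trans (dvd_pow_self _ (Module.finrank_pos (R := k) (M := W)).ne')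
  obtain ⟨w, hw, hw0⟩ := hG.exists_fixed_point_of_prime_dvd_card_of_fixed_point W hdvd
    (a := 0) (fun g => Subtype.ext (map_zero (ρ g)))
  exact ⟨w, hWN w.2, fun h => hw0 (Subtype.ext h.symm), fun g => congrArg Subtype.val (hw g)⟩

/-! ### Locally constant functions and approximation modulo the maximal ideal. -/

/-- The module of locally constant functions that vanish off `Y`. -/
def lcOn (R : Type*) {X : Type*} [Ring R] [TopologicalSpace X] (N : Type*) [AddCommGroup N]
    [Module R N] (Y : Set X) : Submodule R (X → N) where
  carrier := {f | IsLocallyConstant f ∧ ∀ x, x ∉ Y → f x = 0}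
  zero_mem' := ⟨IsLocallyConstant.const 0, fun _ _ => rfl⟩
  add_mem' := fun {f g} hf hg => ⟨hf.1.add hg.1, fun x hx => by simp [hf.2 x hx, hg.2 x hx]⟩
  smul_mem' := fun r f hf => ⟨hf.1.comp (r • ·), fun x hx => by simp [hf.2 x hx]⟩

section LocalRing

open IsLocalRing

variable {R : Type*} [CommRing R] [IsLocalRing R]

/-- The descending chain of submodules stabilizes because `Q` is finite, and Nakayama's lemma shows
that the stable term vanishes. -/
theorem IsLocalRing.exists_pow_maximalIdeal_smul_top_eq_bot (Q : Type*) [AddCommGroup Q]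
    [Module R Q] [Finite Q] : ∃ n, (maximalIdeal R) ^ n • (⊤ : Submodule R Q) = ⊥ := by
  let f : ℕ →o (Submodule R Q)ᵒᵈ :=
    ⟨fun n => OrderDual.toDual ((maximalIdeal R) ^ n • ⊤), fun a b h =>
      Submodule.smul_mono_left (Ideal.pow_le_pow_right h)⟩
  obtain ⟨n, hn⟩ := IsArtinian.monotone_stabilizes f
  refine ⟨n, ?_⟩
  have h : (maximalIdeal R) ^ n • (⊤ : Submodule R Q) = (maximalIdeal R) ^ (n + 1) • ⊤ :=
    hn (n + 1) (Nat.le_succ n)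
  refine Submodule.eq_bot_of_le_smul_of_le_jacobson_bot (maximalIdeal R) _
    (IsNoetherian.noetherian _) ?_ (maximalIdeal_le_jacobson _)
  rw [← Submodule.mul_smul, ← pow_succ', ← h]

/-- If the reductions of `F i` span the locally constant functions that vanish off `Y`, then a
module of functions to a finite module `Q` that contains all `F i • q` contains all locally constant
functions that vanish off `Y`. -/
theorem mem_of_residue_span {X I : Type*} [TopologicalSpace X] {Y : Set X} (F : I → X → R)
    (hF : ∀ i, F i ∈ lcOn R R Y)
    (hspan : lcOn (ResidueField R) (ResidueField R) Y ≤
      Submodule.span (ResidueField R) (Set.range fun i x => residue R (F i x)))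
    {Q : Type*} [AddCommGroup Q] [Module R Q] [Finite Q] (E : Submodule R (X → Q))
    (hE : ∀ i q, (fun x => F i x • q) ∈ E) {g : X → Q} (hg : g ∈ lcOn R Q Y) : g ∈ E := by
  classical
  have hlift : ∀ f ∈ Submodule.span (ResidueField R) (Set.range fun i x => residue R (F i x)),
      ∃ a ∈ Submodule.span R (Set.range F), ∀ x, residue R (a x) = f x := by
    intro f hf
    induction hf using Submodule.span_induction with
    | mem f hf =>
      obtain ⟨i, rfl⟩ := hf
      exact ⟨F i, Submodule.subset_span ⟨i, rfl⟩, fun _ => rfl⟩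
    | zero => exact ⟨0, zero_mem _, fun _ => map_zero _⟩
    | add f g _ _ hf hg =>
      obtain ⟨a, ha, ha'⟩ := hf
      obtain ⟨b, hb, hb'⟩ := hg
      exact ⟨a + b, add_mem ha hb, fun x => by simp [ha', hb']⟩
    | smul c f _ hf =>
      obtain ⟨a, ha, ha'⟩ := hf
      obtain ⟨r, rfl⟩ := residue_surjective c
      exact ⟨r • a, Submodule.smul_mem _ _ ha, fun x => by simp [ha']⟩
  have hspanlc : Submodule.span R (Set.range F) ≤ lcOn R R Y :=
    Submodule.span_le.2 (by rintro _ ⟨i, rfl⟩; exact hF i)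
  have hspanE : ∀ a ∈ Submodule.span R (Set.range F), ∀ q : Q, (fun x => a x • q) ∈ E := by
    intro a ha q
    induction ha using Submodule.span_induction with
    | mem f hf => obtain ⟨i, rfl⟩ := hf; exact hE i q
    | zero => convert E.zero_mem using 1; funext x; simp
    | add f g _ _ hf hg => simpa [add_smul] using! E.add_mem hf hg
    | smul c f _ hf => simpa [mul_smul] using! E.smul_mem c hf
  obtain ⟨n, hn⟩ := exists_pow_maximalIdeal_smul_top_eq_bot (R := R) Q
  -- Downward induction along the filtration of `Q` by powers of the maximal ideal: an element of
  -- `E` agrees with `g` modulo the next step.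
  have key : ∀ j ≤ n, ∀ g ∈ lcOn R Q Y,
      (∀ x, g x ∈ (maximalIdeal R) ^ j • (⊤ : Submodule R Q)) → g ∈ E := by
    intro j hj
    induction hj using Nat.decreasingInduction with
    | self =>
      intro g _ hgn
      have : g = 0 := funext fun x => by simpa [hn] using hgn x
      rw [this]; exact E.zero_mem
    | of_succ j _ ih =>
      intro g hg hgj
      -- The function `a` lifts the indicator of the fibre of `g` over `q`. It must be `0` for `q`
      -- outside the `j`-th step, so that the error lies in step `j + 1`. The value `q = 0` is
      -- exempt: its fibre may leave `Y`, and its term `a x • q` is zero anyway.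
      have hind : ∀ q : Q, ∃ a ∈ Submodule.span R (Set.range F),
          ((q ∉ (maximalIdeal R) ^ j • (⊤ : Submodule R Q)) → a = 0) ∧
          ∀ x, q ≠ 0 → residue R (a x) = if g x = q then 1 else 0 := by
        intro q
        by_cases hqj : q ∉ (maximalIdeal R) ^ j • (⊤ : Submodule R Q)
        · refine ⟨0, zero_mem _, fun _ => rfl, fun x _ => ?_⟩
          rw [if_neg fun h : g x = q => hqj (h ▸ hgj x), Pi.zero_apply, map_zero]
        by_cases hq : q = 0
        · exact ⟨0, zero_mem _, fun _ => rfl, fun x h => absurd hq h⟩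
        · obtain ⟨a, ha, ha'⟩ := hlift (fun x => if g x = q then 1 else 0) (hspan
            ⟨hg.1.comp fun y => if y = q then 1 else 0, fun x hx => by
              simp [hg.2 x hx, Ne.symm hq]⟩)
          exact ⟨a, ha, fun h => absurd h hqj, fun x _ => ha' x⟩
      choose a ha ha0 ha' using hind
      have := Fintype.ofFinite Q
      set e : X → Q := ∑ q : Q, fun x => a q x • q with he
      have heE : e ∈ E := Submodule.sum_mem _ fun q _ => hspanE _ (ha q) q
      have hel : e ∈ lcOn R Q Y := Submodule.sum_mem _ fun q _ =>
        ⟨(hspanlc (ha q)).1.comp (· • q), fun x hx => by simp [(hspanlc (ha q)).2 x hx]⟩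
      rw [← sub_add_cancel g e]
      refine E.add_mem (ih _ (sub_mem hg hel) fun x => ?_) heE
      have hgx : g x = ∑ q : Q, (if g x = q then (1 : R) else 0) • q := by simp
      have hsub : (g - e) x = ∑ q : Q, ((if g x = q then (1 : R) else 0) - a q x) • q := by
        rw [Pi.sub_apply]
        nth_rw 1 [hgx]
        simp [he, sub_smul]
      rw [hsub]
      refine Submodule.sum_mem _ fun q _ => ?_
      by_cases hq : q = 0
      · simp [hq]
      have hm : (if g x = q then (1 : R) else 0) - a q x ∈ maximalIdeal R := by
        rw [← residue_eq_zero_iff, map_sub, ha' q x hq]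
        split_ifs <;> simp
      by_cases hqj : q ∈ (maximalIdeal R) ^ j • (⊤ : Submodule R Q)
      · rw [pow_succ', Submodule.mul_smul]
        exact Submodule.smul_mem_smul hm hqj
      · rw [ha0 q hqj, if_neg fun h : g x = q => hqj (h ▸ hgj x)]
        simp
  exact key 0 (Nat.zero_le n) g hg (by simp)

end LocalRing

/-! ### Profinite modules and coordinates. -/

section Profinite

variable {R : Type u} [CommRing R] [TopologicalSpace R]

/-- An open subgroup `H` avoiding `u` contains a largest submodule, the set of `x` with `R x ⊆ H`.
Compactness of `R` makes it open. -/
theorem exists_isOpen_submodule_notMem [CompactSpace R] {U : Type*} [AddCommGroup U] [Module R U]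
    [TopologicalSpace U] [IsTopologicalAddGroup U] [ContinuousSMul R U] [CompactSpace U] [T2Space U]
    [TotallyDisconnectedSpace U] {u : U} (hu : u ≠ 0) :
    ∃ V : Submodule R U, IsOpen (V : Set U) ∧ u ∉ V := by
  obtain ⟨W, hW, h0, hWu⟩ := compact_exists_isClopen_in_isOpen (isOpen_compl_singleton (x := u))
    (x := 0) hu.symm
  obtain ⟨H, hH⟩ := IsTopologicalAddGroup.exist_openAddSubgroup_sub_clopen_nhds_of_zero hW h0
  refine ⟨⟨⟨⟨{x | ∀ r : R, r • x ∈ H}, ?_⟩, ?_⟩, ?_⟩, ?_, ?_⟩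
  · intro a b ha hb r
    rw [smul_add]
    exact add_mem (ha r) (hb r)
  · intro r
    rw [smul_zero]
    exact zero_mem H
  · intro c x hx r
    rw [smul_smul]
    exact hx _
  · have hcl : IsClosed (Prod.snd '' {p : R × U | p.1 • p.2 ∉ H}) :=
      isClosedMap_snd_of_compactSpace _ ((H.isOpen.preimage continuous_smul).isClosed_compl)
    convert hcl.isOpen_compl using 1
    ext x
    simp
  · intro h
    exact hWu (hH (by simpa using h 1)) rfl

/-- A proper open ideal has finite quotient and lies in the maximal ideal. -/
theorem IsLocalRing.finite_residueField [IsTopologicalRing R] [CompactSpace R] [T2Space R]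
    [TotallyDisconnectedSpace R] [IsLocalRing R] : Finite (IsLocalRing.ResidueField R) := by
  obtain ⟨V, hV, h1⟩ := exists_isOpen_submodule_notMem (R := R) (U := R) one_ne_zero
  have hle : V ≤ IsLocalRing.maximalIdeal R :=
    IsLocalRing.le_maximalIdeal fun h => h1 (by rw [h]; exact Submodule.mem_top)
  have : Finite (R ⧸ V) := AddSubgroup.quotient_finite_of_isOpen V.toAddSubgroup hV
  exact Finite.of_surjective _ (Ideal.Quotient.factor_surjective hle)

namespace IsProfiniteBasis

open IsLocalRing

variable {U : Type v} [AddCommGroup U] [Module R U] [TopologicalSpace U] {B : Set U}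

/-- The target is `PUnit → R` inside the proof because the universal property tests only modules in
universe `max u v`. The same device serves `hom_ext` and `hom_ext'`. -/
theorem exists_extension (hB : IsProfiniteBasis R B) [IsTopologicalRing R]
    [CompactSpace R] [T2Space R] [TotallyDisconnectedSpace R] (φ : (insert 0 B : Set U) → R)
    (hφ : Continuous φ) (h0 : φ ⟨0, Set.mem_insert _ _⟩ = 0) :
    ∃ f : U →L[R] R, ∀ x : (insert 0 B : Set U), f x = φ x := by
  classical
  obtain ⟨f, hf, -⟩ := hB.existsUnique_extension (PUnit.{v + 1} → R)
    (fun u _ => if h : u ∈ insert 0 B then φ ⟨u, h⟩ else 0)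
    (by
      rw [continuousOn_iff_continuous_domRestrict]
      refine continuous_pi fun _ => ?_
      convert hφ using 1
      ext x
      simp only [Set.domRestrict_apply, x.2, dif_pos])
    (by funext _; simpa using! h0)
  refine ⟨(ContinuousLinearMap.proj PUnit.unit).comp f, ?_⟩
  rintro ⟨x, rfl | hx⟩
  · simp [h0]
  · have := congrFun (hf x hx) PUnit.unit
    simpa [hx] using! this

theorem hom_ext (hB : IsProfiniteBasis R B) {N : Type u} [AddCommGroup N] [Module R N]
    [TopologicalSpace N] [IsTopologicalAddGroup N] [ContinuousSMul R N] [CompactSpace N] [T2Space N]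
    [TotallyDisconnectedSpace N] {f g : U →L[R] N} (h : ∀ b ∈ B, f b = g b) : f = g := by
  let c : N →L[R] (PUnit.{v + 1} → N) := ContinuousLinearMap.pi fun _ => .id R N
  obtain ⟨F, -, hF⟩ := hB.existsUnique_extension (PUnit.{v + 1} → N) (c.comp f)
    (c.comp f).continuous.continuousOn (map_zero _)
  have h1 := hF (c.comp f) fun _ _ => rfl
  have h2 := hF (c.comp g) fun b hb => by
    change c (g b) = c (f b)
    rw [h b hb]
  ext u
  exact congrFun (DFunLike.congr_fun (h1.trans h2.symm) u) PUnit.unit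

theorem hom_ext' (hB : IsProfiniteBasis R B) {N : Type v} [AddCommGroup N] [Module R N]
    [TopologicalSpace N] [IsTopologicalAddGroup N] [ContinuousSMul R N] [CompactSpace N] [T2Space N]
    [TotallyDisconnectedSpace N] {f g : U →L[R] N} (h : ∀ b ∈ B, f b = g b) : f = g := by
  let c : N →L[R] (PUnit.{u + 1} → N) := ContinuousLinearMap.pi fun _ => .id R N
  obtain ⟨F, -, hF⟩ := hB.existsUnique_extension (PUnit.{u + 1} → N) (c.comp f)
    (c.comp f).continuous.continuousOn (map_zero _)
  have h1 := hF (c.comp f) fun _ _ => rfl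
  have h2 := hF (c.comp g) fun b hb => by
    change c (g b) = c (f b)
    rw [h b hb]
  ext u
  exact congrFun (DFunLike.congr_fun (h1.trans h2.symm) u) PUnit.unit

/-- A family of continuous functionals whose reductions on `insert 0 B` form a basis of the space of
locally constant functions vanishing at `0` is a system of coordinates. -/
theorem bijective_of_residue_basis (hB : IsProfiniteBasis R B) [IsTopologicalRing R]
    [CompactSpace R] [T2Space R] [TotallyDisconnectedSpace R] [IsLocalRing R]
    [IsTopologicalAddGroup U] [ContinuousSMul R U]
    [CompactSpace U] [T2Space U] [TotallyDisconnectedSpace U] {I : Type*} (F : I → U →L[R] R)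
    (hF : ∀ i, IsLocallyConstant fun x : (insert 0 B : Set U) => F i x)
    (hli : LinearIndependent (ResidueField R)
      fun i (x : (insert 0 B : Set U)) => residue R (F i x))
    (hspan : lcOn (ResidueField R) (ResidueField R) {x : (insert 0 B : Set U) | (x : U) ≠ 0} ≤
      Submodule.span (ResidueField R)
        (Set.range fun i (x : (insert 0 B : Set U)) => residue R (F i x))) :
    Function.Bijective fun u i => F i u := by
  classical
  constructor
  · have hinj : ∀ u : U, (∀ i, F i u = 0) → u = 0 := by
      intro u hu
      by_contra hu0
      -- The homomorphisms to the finite module `U ⧸ V` that kill the common kernel of the `F i`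
      -- restrict to a submodule `E` of functions on `insert 0 B`. By `mem_of_residue_span`, `E`
      -- contains the restriction of the quotient map, so `u ∈ V`.
      obtain ⟨V, hV, huV⟩ := exists_isOpen_submodule_notMem (R := R) hu0
      have hVc : IsClosed (V : Set U) := AddSubgroup.isClosed_of_isOpen V.toAddSubgroup hV
      have : Finite (U ⧸ V) := AddSubgroup.quotient_finite_of_isOpen V.toAddSubgroup hV
      have : T3Space (U ⧸ V) := inferInstance
      let E : Submodule R ((insert 0 B : Set U) → U ⧸ V) :=
        { carrier := {g | ∃ h : U →L[R] U ⧸ V, (∀ u, (∀ i, F i u = 0) → h u = 0) ∧ ∀ x, g x = h x}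
          zero_mem' := ⟨0, fun _ _ => rfl, fun _ => rfl⟩
          add_mem' := by
            rintro a b ⟨h, h1, h2⟩ ⟨h', h1', h2'⟩
            exact ⟨h + h', fun u hu => by simp [h1 u hu, h1' u hu], fun x => by simp [h2, h2']⟩
          smul_mem' := by
            rintro c a ⟨h, h1, h2⟩
            exact ⟨c • h, fun u hu => by simp [h1 u hu], fun x => by simp [h2]⟩ }
      have hmem : (fun x : (insert 0 B : Set U) => V.mkQ x) ∈ E := by
        refine mem_of_residue_span (Y := {x : (insert 0 B : Set U) | (x : U) ≠ 0})
          (fun i (x : (insert 0 B : Set U)) => F i x) (fun i => ⟨hF i, ?_⟩) hspan E (fun i q => ?_)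
          ⟨?_, ?_⟩
        · intro x hx
          simp only [Set.mem_ofPred_eq, not_not] at hx
          simp [hx]
        · exact ⟨(F i).smulRight q, fun u hu => by simp [hu i], fun x => by simp⟩
        · refine (IsLocallyConstant.iff_continuous _).2 ?_
          exact V.continuous_mkQ.comp continuous_subtype_val
        · intro x hx
          simp only [Set.mem_ofPred_eq, not_not] at hx
          simp [hx]
      obtain ⟨h, h1, h2⟩ := hmem
      have heq : h = ⟨V.mkQ, V.continuous_mkQ⟩ :=
        hB.hom_ext' fun b hb => (h2 ⟨b, Set.mem_insert_of_mem _ hb⟩).symm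
      have := h1 u hu
      rw [heq] at this
      exact huV ((Submodule.Quotient.mk_eq_zero V).1 this)
    intro u u' h
    refine sub_eq_zero.1 (hinj _ fun i => ?_)
    rw [map_sub, sub_eq_zero]
    exact congrFun h i
  · intro y
    suffices h : (Set.univ ∩ ⋂ i, {u | F i u = y i}).Nonempty by
      obtain ⟨u, -, hu⟩ := h
      exact ⟨u, funext fun i => by simpa using Set.mem_iInter.1 hu i⟩
    -- By compactness of `U` only finitely many coordinates need to be prescribed at once.
    refine isCompact_univ.inter_iInter_nonempty _
      (fun i => isClosed_eq (F i).continuous continuous_const) fun J => ?_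
    let Ψ : U →ₗ[R] (J → R) := LinearMap.pi fun j => (F j : U →ₗ[R] R)
    let S : Submodule (ResidueField R) (J → ResidueField R) :=
      { carrier := {w | ∃ u, ∀ j, residue R (Ψ u j) = w j}
        zero_mem' := ⟨0, fun _ => by simp⟩
        add_mem' := by
          rintro a b ⟨u, hu⟩ ⟨u', hu'⟩
          exact ⟨u + u', fun j => by simp [hu, hu']⟩
        smul_mem' := by
          rintro c a ⟨u, hu⟩
          obtain ⟨r, rfl⟩ := residue_surjective c
          exact ⟨r • u, fun j => by simp [hu]⟩ }
    -- If the reductions of the values missed part of `J → k`, a functional vanishing on them would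
    -- be a linear relation between the reduced `F j`.
    have hS : S = ⊤ := by
      by_contra hne
      obtain ⟨f, hf0, hf⟩ := Submodule.exists_le_ker_of_lt_top S (lt_top_iff_ne_top.2 hne)
      refine hf0 (LinearMap.pi_ext' fun j => LinearMap.ext_ring ?_)
      have hli' := linearIndependent_iff'.1 (hli.comp (fun j : J => (j : I)) Subtype.val_injective)
        Finset.univ (fun j => f (Pi.single j 1)) (by
          funext x
          have hx : f (fun j : J => residue R (F j x)) = 0 := hf ⟨x, fun _ => rfl⟩
          rw [pi_eq_sum_univ' (fun j : J => residue R (F j x)), map_sum] at hx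
          simp only [map_smul] at hx
          simpa [mul_comm] using hx) j (Finset.mem_univ _)
      simpa using hli'
    -- Nakayama's lemma lifts surjectivity from the residue field to `R`.
    have hΨ : (⊤ : Submodule R (J → R)) ≤ LinearMap.range Ψ := by
      refine Submodule.le_of_le_smul_of_le_jacobson_bot (I := maximalIdeal R)
        (Module.Finite.fg_top) (maximalIdeal_le_jacobson _) ?_
      intro z _
      obtain ⟨u, hu⟩ : (fun j => residue R (z j)) ∈ S := hS ▸ Submodule.mem_top
      rw [← add_sub_cancel (Ψ u) z]
      refine Submodule.add_mem_sup ⟨u, rfl⟩ ?_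
      rw [pi_eq_sum_univ' (z - Ψ u)]
      refine Submodule.sum_mem _ fun j _ => Submodule.smul_mem_smul ?_ Submodule.mem_top
      rw [← residue_eq_zero_iff, Pi.sub_apply, map_sub, hu, sub_self]
    obtain ⟨u, hu⟩ := hΨ (x := fun j => y j) Submodule.mem_top
    refine ⟨u, Set.mem_univ _, Set.mem_iInter₂.2 fun i hi => ?_⟩
    exact congrFun hu ⟨i, hi⟩

end IsProfiniteBasis

end Profinite

/-! ### Functions on a `G`-set and permuted bases. -/

section FunctionRepresentation

/-- The action of `G` on functions on a `G`-set by left translation. -/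
def funRep (k G X : Type*) [CommRing k] [Group G] [MulAction G X] : Representation k G (X → k) where
  toFun g := LinearMap.funLeft k k (g⁻¹ • ·)
  map_one' := by ext f x; simp [LinearMap.funLeft]
  map_mul' g h := by ext f x; simp [LinearMap.funLeft, mul_smul]

variable {k G X : Type*} [Field k] [Group G] [MulAction G X]

@[simp]
theorem funRep_apply (g : G) (f : X → k) (x : X) : funRep k G X g f x = f (g⁻¹ • x) := rfl

/-- Invariance under `H` makes the translate depend only on the coset, so the choice made by `out`
is harmless. -/
theorem funRep_out {H : Subgroup G} {f : X → k} (hf : ∀ h ∈ H, ∀ x, f (h • x) = f x) (g : G) :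
    funRep k G X ((g : G ⧸ H).out) f = funRep k G X g f := by
  obtain ⟨h, hh⟩ := QuotientGroup.mk_out_eq_mul H g
  ext x
  rw [funRep_apply, funRep_apply, hh, mul_inv_rev, mul_smul]
  exact hf _ (inv_mem h.2) _

theorem funRep_funRep_out {H : Subgroup G} {f : X → k} (hf : ∀ h ∈ H, ∀ x, f (h • x) = f x) (g : G)
    (q : G ⧸ H) : funRep k G X g (funRep k G X q.out f) = funRep k G X (g • q).out f := by
  have : g • q = ((g * q.out : G) : G ⧸ H) := by
    conv_lhs => rw [← QuotientGroup.out_eq' q]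
    rfl
  rw [this, funRep_out hf, map_mul]
  rfl

/-- The family `φ` with stabilizers `s` is the family of orbit representatives of a basis of `L` that
is permuted by `G`. -/
structure IsPermFamily (L : Submodule k (X → k)) {ι : Type*} (s : ι → Subgroup G)
    (φ : ι → X → k) : Prop where
  invariant : ∀ i, ∀ h ∈ s i, ∀ x, φ i (h • x) = φ i x
  linearIndependent :
    LinearIndependent k fun t : Σ i, G ⧸ s i => funRep k G X t.2.out (φ t.1)
  span_eq : Submodule.span k (Set.range fun t : Σ i, G ⧸ s i => funRep k G X t.2.out (φ t.1)) = L

/-- The space `L` of functions has a basis that is permuted by `G`. -/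
def HasPermBasis (G : Type*) [Group G] [MulAction G X] (L : Submodule k (X → k)) : Prop :=
  ∃ (I : Set (X → k)) (s : I → Subgroup G), IsPermFamily L s ((↑) : I → X → k)

/-- Independence of the translates makes `φ` injective, so its range can serve as index set.
Indexing by sets of functions avoids quantifying over an index type in `HasPermBasis`. -/
theorem IsPermFamily.hasPermBasis {L : Submodule k (X → k)} {ι : Type*} {s : ι → Subgroup G}
    {φ : ι → X → k} (h : IsPermFamily L s φ) : HasPermBasis G L := by
  have hinj : Function.Injective φ := by
    intro i j hij
    have : (⟨i, ((1 : G) : G ⧸ s i)⟩ : Σ i, G ⧸ s i) = ⟨j, ((1 : G) : G ⧸ s j)⟩ := by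
      refine h.linearIndependent.injective ?_
      change funRep k G X _ (φ i) = funRep k G X _ (φ j)
      rw [funRep_out (h.invariant i), funRep_out (h.invariant j), hij]
    exact congrArg Sigma.fst this
  let e : Set.range φ ≃ ι := (Equiv.ofInjective φ hinj).symm
  have he : ∀ i : Set.range φ, φ (e i) = i := fun i => by
    simp [e, Equiv.apply_ofInjective_symm hinj]
  let E : (Σ i, G ⧸ s (e i)) ≃ Σ i, G ⧸ s i :=
    Equiv.sigmaCongrLeft (β := fun i => G ⧸ s i) e
  have hE : (fun t : Σ i : Set.range φ, G ⧸ s (e i) => funRep k G X t.2.out (t.1 : X → k)) =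
      (fun t : Σ i, G ⧸ s i => funRep k G X t.2.out (φ t.1)) ∘ E := by
    funext t
    rw [← he t.1]
    rfl
  refine ⟨Set.range φ, fun i => s (e i), fun i h' hh' x => ?_, ?_, ?_⟩
  · rw [← he i]
    exact h.invariant _ h' hh' x
  · rw [hE]
    exact h.linearIndependent.comp _ E.injective
  · rw [hE, E.surjective.range_comp]
    exact h.span_eq

/-- A finite relation may be padded with zeros to run over complete fibres `κ i`, which here are
whole `G`-orbits. -/
theorem linearIndependent_sigma_of_sum {V ι : Type*} [AddCommGroup V] [Module k V] {κ : ι → Type*}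
    [∀ i, Fintype (κ i)] (v : (Σ i, κ i) → V)
    (h : ∀ (S : Finset ι) (a : ∀ i, κ i → k), ∑ i ∈ S, ∑ q, a i q • v ⟨i, q⟩ = 0 →
      ∀ i ∈ S, ∀ q, a i q = 0) : LinearIndependent k v := by
  classical
  rw [linearIndependent_iff'']
  intro s a ha hsum
  have h1 : ∑ i ∈ s.image Sigma.fst, ∑ q, a ⟨i, q⟩ • v ⟨i, q⟩ = 0 := by
    rw [Finset.sum_sigma', ← hsum]
    symm
    refine Finset.sum_subset (fun t ht => ?_) fun t _ ht => by rw [ha t ht, zero_smul]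
    exact Finset.mem_sigma.2 ⟨Finset.mem_image_of_mem _ ht, Finset.mem_univ _⟩
  rintro ⟨i, q⟩
  by_cases hi : i ∈ s.image Sigma.fst
  · exact h _ (fun i q => a ⟨i, q⟩) h1 i hi q
  · exact ha _ fun hmem => hi (Finset.mem_image_of_mem Sigma.fst hmem)

end FunctionRepresentation

/-! ### Strata and clopen transversals. -/

section Strata

open MulAction

variable {G X : Type*} [Group G] [MulAction G X]

/-- The union of the orbits that meet `T`. -/
def orbitUnion (G : Type*) {X : Type*} [Group G] [MulAction G X] (T : Set X) : Set X :=
  {x | ∃ g : G, g • x ∈ T}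

theorem subset_orbitUnion (T : Set X) : T ⊆ orbitUnion G T := fun x hx => ⟨1, by simpa⟩

theorem smul_mem_orbitUnion {T : Set X} (g : G) {x : X} (hx : x ∈ orbitUnion G T) :
    g • x ∈ orbitUnion G T := by
  obtain ⟨g', hg'⟩ := hx
  exact ⟨g' * g⁻¹, by simpa [mul_smul] using hg'⟩

theorem eq_zero_of_notMem_orbitUnion_support {k : Type*} [Zero k] {f : X → k} {x : X}
    (hx : x ∉ orbitUnion G (Function.support f)) : f x = 0 := by
  by_contra h
  exact hx (subset_orbitUnion _ h)

variable [TopologicalSpace X]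

theorem isClopen_orbitUnion [Finite G] [ContinuousConstSMul G X] {T : Set X} (hT : IsClopen T) :
    IsClopen (orbitUnion G T) := by
  have : orbitUnion G T = ⋃ g : G, (g • ·) ⁻¹' T := by
    ext x
    simp [orbitUnion]
  rw [this]
  exact isClopen_iUnion_of_finite fun g => hT.preimage (continuous_const_smul g)

theorem IsLocallyConstant.indicator_isClopen {N : Type*} [Zero N] {f : X → N}
    (hf : IsLocallyConstant f) {T : Set X} (hT : IsClopen T) :
    IsLocallyConstant (T.indicator f) := by
  rw [IsLocallyConstant.iff_eventually_eq]
  intro x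
  by_cases hx : x ∈ T
  · filter_upwards [hf.eventually_eq x, hT.isOpen.mem_nhds hx] with y hy hyT
    simp [hx, hyT, hy]
  · filter_upwards [hT.compl.isOpen.mem_nhds hx] with y hyT
    rw [Set.indicator_of_notMem hx, Set.indicator_of_notMem hyT]

/-- An open invariant set, all of whose orbits are isomorphic to `G ⧸ H`. -/
structure IsStratum (H : Subgroup G) (Y : Set X) : Prop where
  isOpen : IsOpen Y
  smul_mem : ∀ (g : G), ∀ x ∈ Y, g • x ∈ Y
  exists_stabilizer_eq : ∀ x ∈ Y, ∃ g : G, stabilizer G (g • x) = H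

/-- The invariant clopen subsets of `Y`. -/
def invClopens (G : Type*) [Group G] [MulAction G X] (Y : Set X) : Set (Set X) :=
  {K | IsClopen K ∧ K ⊆ Y ∧ ∀ (g : G), ∀ x ∈ K, g • x ∈ K}

/-- A clopen subset of `K`, consisting of points with stabilizer `H`, that meets each orbit in `K`
once. -/
structure IsTransversal (H : Subgroup G) (K T : Set X) : Prop where
  isClopen : IsClopen T
  subset : T ⊆ K
  stabilizer_eq : ∀ t ∈ T, stabilizer G t = H
  exists_smul_mem : ∀ x ∈ K, ∃ g : G, g • x ∈ T
  mem_of_smul_mem : ∀ (g : G), ∀ t ∈ T, g • t ∈ T → g ∈ H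

variable {H : Subgroup G} {Y K T : Set X}

/-- Locally, a point with stabilizer `H` has a clopen neighbourhood disjoint from its translates by
each `a ∉ H`. Compactness of `K` leaves finitely many of these, and two are merged by removing from
the second the orbits met by the first. -/
theorem IsStratum.exists_isTransversal [Finite G] [ContinuousConstSMul G X] [CompactSpace X]
    [T2Space X] [TotallyDisconnectedSpace X] (hY : IsStratum H Y) (hK : K ∈ invClopens G Y) :
    ∃ T, IsTransversal H K T := by
  -- Stabilizers in `Y` are conjugate to `H`, so they have the same finite order.
  have hcard : ∀ x ∈ Y, stabilizer G x ≤ H → stabilizer G x = H := by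
    intro x hx hle
    obtain ⟨g, hg⟩ := hY.exists_stabilizer_eq x hx
    refine SetLike.coe_injective (Set.eq_of_subset_of_ncard_le hle ?_ (Set.toFinite _))
    rw [← hg, stabilizer_smul_eq_stabilizer_map_conj, Subgroup.coe_map]
    exact Set.ncard_image_le (Set.toFinite _)
  have key : ∃ T : Set X, IsClopen T ∧ T ⊆ Y ∧ (∀ t ∈ T, stabilizer G t = H) ∧
      (∀ x ∈ K, ∃ g : G, g • x ∈ T) ∧ ∀ (g : G), ∀ t ∈ T, g • t ∈ T → g ∈ H := by
    refine hK.1.isClosed.isCompact.induction_on (p := fun S => ∃ T : Set X, IsClopen T ∧ T ⊆ Y ∧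
      (∀ t ∈ T, stabilizer G t = H) ∧
      (∀ x ∈ S, ∃ g : G, g • x ∈ T) ∧ ∀ (g : G), ∀ t ∈ T, g • t ∈ T → g ∈ H) ?_ ?_ ?_ ?_
    · exact ⟨∅, isClopen_empty, by simp, by simp, by simp, by simp⟩
    · rintro S S' hS ⟨T, h1, h2, h3, h4, h5⟩
      exact ⟨T, h1, h2, h3, fun x hx => h4 x (hS hx), h5⟩
    · rintro S S' ⟨T, h1, h2, h3, h4, h5⟩ ⟨T', h1', h2', h3', h4', h5'⟩
      refine ⟨T ∪ (T' \ orbitUnion G T), h1.union (h1'.diff (isClopen_orbitUnion h1)),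
        Set.union_subset h2 (Set.sdiff_subset.trans h2'), ?_, ?_, ?_⟩
      · rintro t (ht | ht)
        exacts [h3 t ht, h3' t ht.1]
      · rintro x (hx | hx)
        · obtain ⟨g, hg⟩ := h4 x hx
          exact ⟨g, Or.inl hg⟩
        · obtain ⟨g, hg⟩ := h4' x hx
          by_cases h : g • x ∈ orbitUnion G T
          · obtain ⟨g', hg'⟩ := h
            exact ⟨g' * g, Or.inl (by rwa [mul_smul])⟩
          · exact ⟨g, Or.inr ⟨hg, h⟩⟩
      · rintro g t (ht | ht) (hgt | hgt)
        · exact h5 g t ht hgt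
        · exact absurd ⟨g⁻¹, by simpa using ht⟩ hgt.2
        · exact absurd ⟨g, hgt⟩ ht.2
        · exact h5' g t ht.1 hgt.1
    · intro x hx
      obtain ⟨g, hg⟩ := hY.exists_stabilizer_eq x (hK.2.1 hx)
      set y := g • x
      have hyY : y ∈ Y := hY.smul_mem g x (hK.2.1 hx)
      have hsep : ∀ a : G, ∃ C : Set X, IsClopen C ∧ y ∈ C ∧ (a ∉ H → ∀ z ∈ C, a • z ∉ C) := by
        intro a
        by_cases ha : a ∈ H
        · exact ⟨Set.univ, isClopen_univ, trivial, fun h => absurd ha h⟩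
        · have hay : a • y ≠ y := fun h => ha (hg ▸ mem_stabilizer_iff.2 h)
          obtain ⟨D, hD, hyD, hDa⟩ := compact_exists_isClopen_in_isOpen
            (isOpen_compl_singleton (x := a • y)) (x := y) hay.symm
          refine ⟨D \ (a • ·) ⁻¹' D, hD.diff (hD.preimage (continuous_const_smul a)),
            ⟨hyD, fun h => hDa h rfl⟩, fun _ z hz h => hz.2 h.1⟩
      choose C hC hyC hCa using hsep
      obtain ⟨D, hD, hyD, hDY⟩ := compact_exists_isClopen_in_isOpen hY.isOpen hyY
      set T := D ∩ ⋂ a, C a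
      have hTc : IsClopen T := hD.inter (isClopen_iInter_of_finite hC)
      have hmem : ∀ (a : G), ∀ t ∈ T, a • t ∈ T → a ∈ H := by
        intro a t ht hat
        by_contra ha
        exact hCa a ha t (Set.mem_iInter.1 ht.2 a) (Set.mem_iInter.1 hat.2 a)
      refine ⟨orbitUnion G T, mem_nhdsWithin_of_mem_nhds
        ((isClopen_orbitUnion hTc).isOpen.mem_nhds ⟨g, hyD, Set.mem_iInter.2 hyC⟩), T, hTc,
        fun t ht => hDY ht.1, fun t ht => hcard t (hDY ht.1) fun a ha => ?_, fun _ h => h, hmem⟩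
      exact hmem a t ht (by rwa [mem_stabilizer_iff.1 ha])
  obtain ⟨T, h1, h2, h3, h4, h5⟩ := key
  refine ⟨T ∩ K, h1.inter hK.1, Set.inter_subset_right, fun t ht => h3 t ht.1, fun x hx => ?_,
    fun g t ht hgt => h5 g t ht.1 hgt.1⟩
  obtain ⟨g, hg⟩ := h4 x hx
  exact ⟨g, hg, hK.2.2 g x hx⟩

namespace IsTransversal

theorem smul_mem_iff (hT : IsTransversal H K T) {g : G} {t : X} (ht : t ∈ T) :
    g • t ∈ T ↔ g ∈ H := by
  refine ⟨hT.mem_of_smul_mem g t ht, fun hg => ?_⟩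
  rw [← hT.stabilizer_eq t ht, mem_stabilizer_iff] at hg
  rwa [hg]

theorem smul_eq (hT : IsTransversal H K T) {g : G} {t : X} (ht : t ∈ T) (hg : g ∈ H) :
    g • t = t := by
  rwa [← hT.stabilizer_eq t ht, mem_stabilizer_iff] at hg

/-- `H` fixes `T` pointwise, hence moves no outside point into `T`. -/
theorem invariant_of_eq_zero (hT : IsTransversal H K T) {N : Type*} [Zero N] {f : X → N}
    (hf : ∀ x, x ∉ T → f x = 0) : ∀ h ∈ H, ∀ x, f (h • x) = f x := by
  intro h hh x
  by_cases hx : x ∈ T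
  · rw [hT.smul_eq hx hh]
  · have : h • x ∉ T := by
      intro hhx
      have := hT.smul_eq hhx (inv_mem hh)
      rw [inv_smul_smul] at this
      exact hx (this ▸ hhx)
    rw [hf _ hx, hf _ this]

theorem existsUnique_inv_smul_mem (hT : IsTransversal H K T) {x : X} (hx : x ∈ K) :
    ∃! q : G ⧸ H, q.out⁻¹ • x ∈ T := by
  obtain ⟨g, hg⟩ := hT.exists_smul_mem x hx
  refine ⟨((g⁻¹ : G) : G ⧸ H), ?_, fun q hq => ?_⟩
  · obtain ⟨h, hh⟩ := QuotientGroup.mk_out_eq_mul H g⁻¹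
    simp only [hh, mul_inv_rev, inv_inv, mul_smul]
    rwa [hT.smul_eq hg (inv_mem h.2)]
  · refine (QuotientGroup.out_eq' q).symm.trans (QuotientGroup.eq.2 ?_)
    rw [← hT.smul_mem_iff hg]
    simpa [mul_smul] using hq

theorem inv_smul_smul_mem_iff (hT : IsTransversal H K T) {t : X} (ht : t ∈ T) (q q' : G ⧸ H) :
    q'.out⁻¹ • q.out • t ∈ T ↔ q' = q := by
  rw [← mul_smul, hT.smul_mem_iff ht, ← QuotientGroup.eq, QuotientGroup.out_eq',
    QuotientGroup.out_eq']

theorem sum_inv_smul [Fintype (G ⧸ H)] (hT : IsTransversal H K T) {N : Type*}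
    [AddCommMonoid N] (F : G ⧸ H → X → N) (hF : ∀ q x, x ∉ T → F q x = 0) {t : X} (ht : t ∈ T)
    (q : G ⧸ H) : ∑ q' : G ⧸ H, F q' (q'.out⁻¹ • q.out • t) = F q t := by
  rw [Finset.sum_eq_single q]
  · rw [inv_smul_smul]
  · intro q' _ hq
    exact hF _ _ fun h => hq ((hT.inv_smul_smul_mem_iff ht q q').1 h)
  · simp

theorem exists_eq_smul (hT : IsTransversal H K T) {x : X} (hx : x ∈ K) :
    ∃ (q : G ⧸ H), ∃ t ∈ T, x = q.out • t := by
  obtain ⟨q, hq, -⟩ := hT.existsUnique_inv_smul_mem hx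
  exact ⟨q, _, hq, by simp⟩

theorem inv_smul_notMem (hT : IsTransversal H K T) (hK : K ∈ invClopens G Y) {x : X} (hx : x ∉ K)
    (g : G) : g⁻¹ • x ∉ T := by
  intro h
  have := hK.2.2 g _ (hT.subset h)
  rw [smul_inv_smul] at this
  exact hx this

/-- Functions supported on `K` decompose into translates of functions supported on the
transversal. -/
theorem eq_sum_funRep_indicator [Fintype (G ⧸ H)] (hT : IsTransversal H K T)
    (hK : K ∈ invClopens G Y) {k : Type*} [Field k] {f : X → k} (hf : ∀ x, x ∉ K → f x = 0) :
    f = ∑ q : G ⧸ H, funRep k G X q.out (T.indicator fun x => f (q.out • x)) := by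
  ext x
  simp only [Finset.sum_apply, funRep_apply]
  by_cases hx : x ∈ K
  · obtain ⟨q, t, ht, rfl⟩ := hT.exists_eq_smul hx
    rw [hT.sum_inv_smul (fun q => T.indicator fun x => f (q.out • x))
      (fun q x hx => Set.indicator_of_notMem hx _) ht, Set.indicator_of_mem ht]
  · rw [hf x hx]
    refine (Finset.sum_eq_zero fun q _ => ?_).symm
    exact Set.indicator_of_notMem (hT.inv_smul_notMem hK hx _) _

/-- The translates of the indicator function of a transversal of `K` add up to the indicator
function of `K`. -/
theorem sum_funRep_indicator_one [Fintype (G ⧸ H)] (hT : IsTransversal H K T)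
    (hK : K ∈ invClopens G Y) {k : Type*} [Field k] :
    ∑ q : G ⧸ H, funRep k G X q.out (T.indicator 1) = K.indicator (1 : X → k) := by
  rw [hT.eq_sum_funRep_indicator hK (f := K.indicator (1 : X → k))
    fun x hx => Set.indicator_of_notMem hx _]
  refine Finset.sum_congr rfl fun q _ => congrArg _ (Set.indicator_congr fun x hx => ?_)
  rw [Set.indicator_of_mem (hK.2.2 _ _ (hT.subset hx))]
  rfl

end IsTransversal

section Functions

variable {k : Type*} [Field k]

theorem funRep_mem_lcOn [ContinuousConstSMul G X] (hY : ∀ (g : G), ∀ x ∈ Y, g • x ∈ Y) (g : G)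
    {f : X → k} (hf : f ∈ lcOn k k Y) : funRep k G X g f ∈ lcOn k k Y := by
  refine ⟨hf.1.comp_continuous (continuous_const_smul g⁻¹), fun x hx => hf.2 _ fun h => hx ?_⟩
  simpa using hY g _ h

/-- The set of points whose orbit meets the support of `f`. -/
theorem orbitUnion_support_mem_invClopens [Finite G] [ContinuousConstSMul G X]
    (hY : ∀ (g : G), ∀ x ∈ Y, g • x ∈ Y) {f : X → k} (hf : f ∈ lcOn k k Y) :
    orbitUnion G (Function.support f) ∈ invClopens G Y := by
  refine ⟨isClopen_orbitUnion ?_, ?_, fun g x hx => smul_mem_orbitUnion g hx⟩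
  · have : Function.support f = (f ⁻¹' {0})ᶜ := by ext; simp
    rw [this]
    exact (hf.1.isClopen_fiber 0).compl
  · rintro x ⟨g, hg⟩
    by_contra hx
    refine hg (hf.2 _ fun h => hx ?_)
    simpa using hY g⁻¹ _ h

theorem indicator_mem_lcOn {f : X → k} (hf : IsLocallyConstant f) (hT : IsClopen T) (hTY : T ⊆ Y) :
    T.indicator f ∈ lcOn k k Y :=
  ⟨hf.indicator_isClopen hT, fun _ hx => Set.indicator_of_notMem (fun h => hx (hTY h)) _⟩

/-- If all of `Y` has a transversal then the space of functions on `Y` has a permutation basis. -/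
theorem IsTransversal.hasPermBasis [Finite G] [ContinuousConstSMul G X]
    (hT : IsTransversal H Y T) (hY : Y ∈ invClopens G Y) : HasPermBasis G (lcOn k k Y) := by
  have := Fintype.ofFinite (G ⧸ H)
  -- `Y` is the disjoint union of the translates `q T`, so any basis of the functions on `T`
  -- supplies orbit representatives.
  let b := Module.Basis.ofVectorSpace k (lcOn k k T)
  have hb0 : ∀ i, ∀ x, x ∉ T → (b i : X → k) x = 0 := fun i => (b i).2.2
  have hbinv := fun i => hT.invariant_of_eq_zero (hb0 i)
  refine IsPermFamily.hasPermBasis (s := fun _ => H) (φ := fun i => (b i : X → k))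
    ⟨hbinv, ?_, ?_⟩
  · refine linearIndependent_sigma_of_sum _ fun S a hsum i hi q => ?_
    have hb := linearIndependent_iff'.1 (b.linearIndependent.map' (lcOn k k T).subtype (by simp))
    refine hb S (fun i => a i q) ?_ i hi
    ext x
    simp only [Finset.sum_apply, Pi.smul_apply, Pi.zero_apply, Function.comp_apply,
      Submodule.subtype_apply]
    by_cases hx : x ∈ T
    · have := congrFun hsum (q.out • x)
      simp only [Finset.sum_apply, Pi.smul_apply, Pi.zero_apply, funRep_apply] at this
      rw [← this]
      refine Finset.sum_congr rfl fun i _ => ?_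
      exact (hT.sum_inv_smul (fun q x => a i q • (b i : X → k) x)
        (fun q x hx => by rw [hb0 i x hx, smul_zero]) hx q).symm
    · exact Finset.sum_eq_zero fun i _ => by rw [hb0 i x hx, smul_zero]
  · refine le_antisymm (Submodule.span_le.2 ?_) fun f hf => ?_
    · rintro _ ⟨⟨i, q⟩, rfl⟩
      exact funRep_mem_lcOn hY.2.2 _ ⟨(b i).2.1, fun x hx => hb0 i x fun h => hx (hT.subset h)⟩
    · rw [hT.eq_sum_funRep_indicator hY hf.2]
      refine Submodule.sum_mem _ fun q _ => ?_
      let f' : lcOn k k T := ⟨_, indicator_mem_lcOn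
        (hf.1.comp_continuous (continuous_const_smul q.out)) hT.isClopen subset_rfl⟩
      have hmap := Submodule.mem_map_of_mem (f := (funRep k G X q.out) ∘ₗ (lcOn k k T).subtype)
        (b.mem_span f')
      rw [Submodule.map_span] at hmap
      refine Submodule.span_mono ?_ hmap
      rintro _ ⟨_, ⟨i, rfl⟩, rfl⟩
      exact ⟨⟨i, q⟩, rfl⟩

end Functions

end Strata

/-! ### Strata when `p = 0` in `k`. -/

section ModularStrata

open MulAction

variable {G X : Type*} [Group G] [MulAction G X]

/-- The sum of the values of `f` on the orbit of a point. -/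
noncomputable def orbitSum (G : Type*) {X : Type*} [Group G] [MulAction G X] {k : Type*} [Field k]
    (f : X → k) (x : X) : k :=
  ∑ᶠ z ∈ orbit G x, f z

theorem orbitSum_smul {k : Type*} [Field k] (f : X → k) (g : G) (x : X) :
    orbitSum G f (g • x) = orbitSum G f x := by
  rw [orbitSum, orbitSum, orbit_smul]

theorem orbitSum_eq {k : Type*} [Field k] {H : Subgroup G} [Fintype (G ⧸ H)] (f : X → k) {x : X}
    (hx : stabilizer G x = H) : orbitSum G f x = ∑ q : G ⧸ H, f (q.out • x) := by
  have hinj : Function.Injective fun q : G ⧸ H => q.out • x := by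
    intro q q' h
    rw [← QuotientGroup.out_eq' q, ← QuotientGroup.out_eq' q', QuotientGroup.eq]
    refine hx.le ?_
    rw [mem_stabilizer_iff, mul_smul]
    change q.out⁻¹ • (fun q : G ⧸ H => q.out • x) q' = x
    rw [← h, inv_smul_smul]
  have hrange : orbit G x = Set.range fun q : G ⧸ H => q.out • x := by
    ext z
    constructor
    · rintro ⟨g, rfl⟩
      obtain ⟨h, hh⟩ := QuotientGroup.mk_out_eq_mul H g
      refine ⟨(g : G ⧸ H), ?_⟩
      have : (h : G) • x = x := by
        rw [← mem_stabilizer_iff, hx]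
        exact h.2
      simp only [hh, mul_smul, this]
    · rintro ⟨q, rfl⟩
      exact ⟨_, rfl⟩
  rw [orbitSum, hrange, finsum_mem_range hinj, finsum_eq_sum_of_fintype]

theorem orbitSum_add [Finite G] {k : Type*} [Field k] (f f' : X → k) :
    orbitSum G (f + f') = orbitSum G f + orbitSum G f' :=
  funext fun _ => finsum_mem_add_distrib (Set.finite_range _)

theorem orbitSum_const_smul [Finite G] {k : Type*} [Field k] (c : k) (f : X → k) :
    orbitSum G (c • f) = c • orbitSum G f :=
  funext fun x => by
    rw [Pi.smul_apply, orbitSum, orbitSum, smul_finsum_mem (s := orbit G x) (Set.finite_range _)]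
    rfl

variable [TopologicalSpace X] {H : Subgroup G} {Y : Set X} {k : Type*} [Field k]

/-- The orbit sum of a function on a stratum is again a locally constant function. -/
theorem IsStratum.orbitSum_mem_lcOn [Finite G] [ContinuousConstSMul G X] [CompactSpace X]
    [T2Space X] [TotallyDisconnectedSpace X] (hY : IsStratum H Y) {f : X → k}
    (hf : f ∈ lcOn k k Y) : orbitSum G f ∈ lcOn k k Y := by
  have := Fintype.ofFinite (G ⧸ H)
  have hK := orbitUnion_support_mem_invClopens hY.smul_mem hf
  set K := orbitUnion G (Function.support f)
  obtain ⟨T, hT⟩ := hY.exists_isTransversal hK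
  have h0 : ∀ x, x ∉ K → orbitSum G f x = 0 := by
    intro x hx
    refine finsum_mem_eq_zero_of_forall_eq_zero (s := orbit G x) ?_
    rintro _ ⟨g, rfl⟩
    refine eq_zero_of_notMem_orbitUnion_support (G := G) fun h => hx ?_
    simpa using hK.2.2 g⁻¹ _ h
  -- Local constancy is checked on a transversal, where the orbit sum is a finite sum of translates
  -- of `f`.
  rw [hT.eq_sum_funRep_indicator hK h0]
  refine Submodule.sum_mem _ fun q _ => funRep_mem_lcOn hY.smul_mem _ ?_
  have : (T.indicator fun x => orbitSum G f (q.out • x)) =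
      T.indicator (∑ q : G ⧸ H, fun x => f (q.out • x)) := by
    refine Set.indicator_congr fun x hx => ?_
    rw [orbitSum_smul, orbitSum_eq f (hT.stabilizer_eq x hx), Finset.sum_apply]
  rw [this]
  refine indicator_mem_lcOn ?_ hT.isClopen (hT.subset.trans hK.2.1)
  exact (Submodule.sum_mem (lcOn k k Set.univ) fun q _ =>
    ⟨hf.1.comp_continuous (continuous_const_smul _), fun x hx => absurd trivial hx⟩ :
      (∑ q : G ⧸ H, fun x => f (q.out • x)) ∈ lcOn k k Set.univ).1

theorem IsTransversal.orbitSum_indicator_one [Finite G] {K T : Set X} (hT : IsTransversal H K T)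
    (hK : K ∈ invClopens G Y) : orbitSum G (T.indicator (1 : X → k)) = K.indicator 1 := by
  classical
  have := Fintype.ofFinite (G ⧸ H)
  ext x
  by_cases hx : x ∈ K
  · obtain ⟨g, hg⟩ := hT.exists_smul_mem x hx
    rw [← orbitSum_smul _ g, orbitSum_eq _ (hT.stabilizer_eq _ hg), Set.indicator_of_mem hx,
      Finset.sum_eq_single ((1 : G) : G ⧸ H)]
    · refine Set.indicator_of_mem ((hT.smul_mem_iff hg).2 ?_) _
      obtain ⟨h, hh⟩ := QuotientGroup.mk_out_eq_mul H 1
      rw [hh, one_mul]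
      exact h.2
    · intro q _ hq
      refine Set.indicator_of_notMem (fun h => hq ?_) _
      rw [hT.smul_mem_iff hg] at h
      rw [← QuotientGroup.out_eq' q, eq_comm, QuotientGroup.eq]
      simpa using h
    · simp
  · rw [Set.indicator_of_notMem hx]
    refine finsum_mem_eq_zero_of_forall_eq_zero ?_
    rintro _ ⟨g, rfl⟩
    refine Set.indicator_of_notMem (fun h => hx ?_) _
    simpa using hK.2.2 g⁻¹ _ (hT.subset h)

/-- `k` is finite, and the fibres of `f` over nonzero values are invariant clopen subsets of `Y`. -/
theorem mem_span_indicator_of_invariant [Finite k] [ContinuousConstSMul G X] {f : X → k}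
    (hf : f ∈ lcOn k k Y) (hinv : ∀ (g : G) x, f (g • x) = f x) :
    f ∈ Submodule.span k ((fun K => K.indicator (1 : X → k)) '' invClopens G Y) := by
  classical
  have := Fintype.ofFinite k
  have : f = ∑ c : k, c • (f ⁻¹' {c}).indicator (1 : X → k) := by
    ext x
    simp [Finset.sum_apply, Set.indicator_apply]
  rw [this]
  refine Submodule.sum_mem _ fun c _ => ?_
  by_cases hc : c = 0
  · simp [hc]
  refine Submodule.smul_mem _ _ (Submodule.subset_span ⟨_, ⟨hf.1.isClopen_fiber c, ?_, ?_⟩, rfl⟩)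
  · intro x hx
    by_contra hxY
    exact hc (hx.symm.trans (hf.2 x hxY))
  · intro g x hx
    exact (hinv g x).trans hx

/-- The action of `G` on the functions on an invariant set. -/
def lcRep [ContinuousConstSMul G X] (hY : ∀ (g : G), ∀ x ∈ Y, g • x ∈ Y) :
    Representation k G (lcOn k k Y) where
  toFun g := (funRep k G X g).restrict fun _ hf => funRep_mem_lcOn hY g hf
  map_one' := by ext; simp
  map_mul' g h := by ext; simp

@[simp]
theorem coe_lcRep [ContinuousConstSMul G X] (hY : ∀ (g : G), ∀ x ∈ Y, g • x ∈ Y) (g : G)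
    (f : lcOn k k Y) : (lcRep hY g f : X → k) = funRep k G X g f := rfl

/-- An invariant functional kills the functions whose orbit sums vanish. -/
theorem IsStratum.eq_zero_of_orbitSum_eq_zero [Finite G] [ContinuousConstSMul G X] [CompactSpace X]
    [T2Space X] [TotallyDisconnectedSpace X] (hY : IsStratum H Y)
    (ξ : Module.Dual k (lcOn k k Y)) (hξ : ∀ g f, ξ (lcRep hY.smul_mem g f) = ξ f)
    (f : lcOn k k Y) (hf : orbitSum G (f : X → k) = 0) : ξ f = 0 := by
  have := Fintype.ofFinite (G ⧸ H)
  have hK := orbitUnion_support_mem_invClopens hY.smul_mem f.2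
  obtain ⟨T, hT⟩ := hY.exists_isTransversal hK
  let c : G ⧸ H → lcOn k k Y := fun q => ⟨T.indicator fun x => (f : X → k) (q.out • x),
    indicator_mem_lcOn (f.2.1.comp_continuous (continuous_const_smul q.out)) hT.isClopen
      (hT.subset.trans hK.2.1)⟩
  have h1 : f = ∑ q, lcRep hY.smul_mem q.out (c q) := by
    apply Subtype.ext
    rw [AddSubmonoidClass.coe_finsetSum]
    exact hT.eq_sum_funRep_indicator hK fun x hx => eq_zero_of_notMem_orbitUnion_support hx
  -- The pieces of `f`, moved back to the transversal, add up to the orbit sum. An invariant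
  -- functional does not notice the moving.
  have h2 : ∑ q, c q = 0 := by
    apply Subtype.ext
    rw [AddSubmonoidClass.coe_finsetSum]
    ext x
    rw [Finset.sum_apply]
    by_cases hx : x ∈ T
    · simp only [c, Set.indicator_of_mem hx]
      rw [← orbitSum_eq _ (hT.stabilizer_eq x hx), hf]
      rfl
    · simp [c, Set.indicator_of_notMem hx]
  rw [h1, map_sum]
  simp only [hξ]
  rw [← map_sum, h2, map_zero]

/-- In characteristic `p`, the functions on a stratum of a space acted on by a `p`-group have a
permutation basis. -/
theorem IsStratum.hasPermBasis_of_isPGroup [Finite G] [ContinuousConstSMul G X] [CompactSpace X]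
    [T2Space X] [TotallyDisconnectedSpace X] [Finite k] {p : ℕ} [Fact p.Prime] (hG : IsPGroup p G)
    (hk : (p : k) = 0) (hY : IsStratum H Y) : HasPermBasis G (lcOn k k Y) := by
  classical
  have := Fintype.ofFinite (G ⧸ H)
  -- A basis of the span of the indicators of invariant clopens. Each member is the indicator of
  -- some `K i`; the indicator `φ i` of a transversal of `K i` has it as orbit sum.
  obtain ⟨b, hbsub, hbspan, hbli⟩ := exists_linearIndependent k
    ((fun K => K.indicator (1 : X → k)) '' invClopens G Y)
  choose K hK hKb using fun i : b => hbsub i.2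
  choose T hT using fun i => hY.exists_isTransversal (hK i)
  let φ : b → X → k := fun i => (T i).indicator 1
  have hφL : ∀ i, φ i ∈ lcOn k k Y := fun i =>
    indicator_mem_lcOn (IsLocallyConstant.const 1) (hT i).isClopen ((hT i).subset.trans (hK i).2.1)
  have hφinv : ∀ i, ∀ h ∈ H, ∀ x, φ i (h • x) = φ i x := fun i =>
    (hT i).invariant_of_eq_zero fun x hx => Set.indicator_of_notMem hx _
  have hφsum : ∀ i, ∑ q : G ⧸ H, funRep k G X q.out (φ i) = i := fun i =>
    ((hT i).sum_funRep_indicator_one (hK i)).trans (hKb i)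
  have hφorb : ∀ i, orbitSum G (φ i) = i := fun i =>
    ((hT i).orbitSum_indicator_one (hK i)).trans (hKb i)
  refine IsPermFamily.hasPermBasis (s := fun _ => H) (φ := φ) ⟨hφinv, ?_, ?_⟩
  · refine linearIndependent_sigma_of_sum _ fun S a hsum => ?_
    let ρ : Representation k G (S → G ⧸ H → k) :=
      { toFun := fun g => LinearMap.pi fun i => funRep k G (G ⧸ H) g ∘ₗ LinearMap.proj i
        map_one' := by ext; simp
        map_mul' := fun g h => by ext; simp }
    let Λ : (S → G ⧸ H → k) →ₗ[k] (X → k) :=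
      ∑ i : S, ∑ q : G ⧸ H, LinearMap.toSpanSingleton k _ (funRep k G X q.out (φ i)) ∘ₗ
        LinearMap.proj q ∘ₗ LinearMap.proj i
    have hΛ : ∀ c, Λ c = ∑ i : S, ∑ q : G ⧸ H, c i q • funRep k G X q.out (φ i) := fun c => by
      simp [Λ, LinearMap.sum_apply]
    have hΛρ : ∀ g c, Λ (ρ g c) = funRep k G X g (Λ c) := by
      intro g c
      rw [hΛ, hΛ, map_sum]
      refine Finset.sum_congr rfl fun i _ => ?_
      rw [map_sum, ← Equiv.sum_comp (MulAction.toPerm g)]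
      refine Finset.sum_congr rfl fun q _ => ?_
      rw [map_smul, funRep_funRep_out (hφinv i)]
      simp [ρ]
    -- A nonzero kernel would contain a nonzero `G`-fixed vector. Its coefficients are constant on
    -- each `G ⧸ H`, which turns it into a relation between the members of `b`.
    have hker : LinearMap.ker Λ = ⊥ := by
      by_contra hne
      obtain ⟨c, hc, hc0, hcfix⟩ := hG.exists_fixed_vector hk ρ (LinearMap.ker Λ)
        (fun g v hv => by
          rw [LinearMap.mem_ker] at hv ⊢
          rw [hΛρ, hv, map_zero]) hne
      have hconst : ∀ i q, c i q = c i ((1 : G) : G ⧸ H) := by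
        intro i q
        conv_lhs => rw [← hcfix q.out]
        have : q.out⁻¹ • q = ((1 : G) : G ⧸ H) := by
          rw [inv_smul_eq_iff]
          conv_lhs => rw [← QuotientGroup.out_eq' q]
          change _ = ((q.out * 1 : G) : G ⧸ H)
          rw [mul_one]
        simp [ρ, this]
      rw [LinearMap.mem_ker, hΛ] at hc
      simp only [hconst] at hc
      simp only [← Finset.smul_sum, hφsum] at hc
      have hli := linearIndependent_iff'.1 (hbli.comp ((↑) : S → b) Subtype.val_injective)
        Finset.univ (fun i => c i ((1 : G) : G ⧸ H)) hc
      refine hc0 (funext fun i => funext fun q => ?_)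
      rw [hconst]
      exact hli i (Finset.mem_univ i)
    have hz : (fun (i : S) q => a i q) ∈ LinearMap.ker Λ := by
      rw [LinearMap.mem_ker, hΛ, ← hsum, ← Finset.sum_coe_sort S]
    rw [hker, Submodule.mem_bot] at hz
    intro i hi q
    exact congrFun (congrFun hz ⟨i, hi⟩) q
  · set M := Submodule.span k (Set.range fun t : Σ _ : b, G ⧸ H => funRep k G X t.2.out (φ t.1))
    have hML : M ≤ lcOn k k Y := Submodule.span_le.2 (by
      rintro _ ⟨⟨i, q⟩, rfl⟩
      exact funRep_mem_lcOn hY.smul_mem _ (hφL i))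
    have hMinv : ∀ g, ∀ f ∈ M, funRep k G X g f ∈ M := by
      intro g f hf
      have hle : M ≤ M.comap (funRep k G X g) := by
        refine Submodule.span_le.2 ?_
        rintro _ ⟨⟨i, q⟩, rfl⟩
        refine Submodule.subset_span ⟨⟨i, g • q⟩, ?_⟩
        exact (funRep_funRep_out (hφinv i) g q).symm
      exact hle hf
    have hφM : ∀ i, φ i ∈ M := fun i =>
      Submodule.subset_span ⟨⟨i, ((1 : G) : G ⧸ H)⟩, by
        simp only [funRep_out (hφinv i), map_one]; rfl⟩
    let M' : Submodule k (lcOn k k Y) := M.comap (lcOn k k Y).subtype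
    suffices hM' : M' = ⊤ by
      refine le_antisymm hML fun f hf => ?_
      have : (⟨f, hf⟩ : lcOn k k Y) ∈ M' := hM' ▸ Submodule.mem_top
      exact this
    by_contra hne
    obtain ⟨ξ₀, hξ₀, hξ₀M⟩ := Submodule.exists_le_ker_of_lt_top M' (lt_top_iff_ne_top.2 hne)
    -- If the translates do not span, some nonzero invariant functional `ξ` vanishes on them. Since
    -- `ξ f` depends only on the orbit sum of `f`, and `M` realizes every such orbit sum, `ξ = 0`.
    obtain ⟨ξ, hξ, hξ0, hξfix⟩ := hG.exists_fixed_vector hk (lcRep hY.smul_mem).dual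
      M'.dualAnnihilator
      (fun g ξ hξ => by
        rw [Submodule.mem_dualAnnihilator] at hξ ⊢
        exact fun f hf => hξ _ (hMinv g⁻¹ f hf))
      (fun h => hξ₀ (by
        have : ξ₀ ∈ M'.dualAnnihilator := (Submodule.mem_dualAnnihilator _).2 fun f hf => hξ₀M hf
        rwa [h, Submodule.mem_bot] at this))
    have hξinv : ∀ g f, ξ (lcRep hY.smul_mem g f) = ξ f := by
      intro g f
      conv_rhs => rw [← hξfix g⁻¹]
      rw [Representation.dual_apply, inv_inv]
      rfl
    refine hξ0 (LinearMap.ext fun f => ?_)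
    have horb := hY.orbitSum_mem_lcOn f.2
    have hspan := mem_span_indicator_of_invariant horb fun g x => orbitSum_smul _ g x
    rw [← hbspan] at hspan
    -- a combination of the `φ i` with the same orbit sums as `f`
    obtain ⟨f', hf', hff'⟩ : ∃ f' ∈ M, orbitSum G f' = orbitSum G (f : X → k) := by
      generalize orbitSum G (f : X → k) = m at hspan
      induction hspan using Submodule.span_induction with
      | mem m hm => exact ⟨φ ⟨m, hm⟩, hφM _, hφorb _⟩
      | zero => exact ⟨0, zero_mem _, by simpa using orbitSum_const_smul (0 : k) (0 : X → k)⟩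
      | add m m' _ _ h h' =>
        obtain ⟨a, ha, rfl⟩ := h
        obtain ⟨a', ha', rfl⟩ := h'
        exact ⟨a + a', add_mem ha ha', orbitSum_add a a'⟩
      | smul c m _ h =>
        obtain ⟨a, ha, rfl⟩ := h
        exact ⟨c • a, Submodule.smul_mem _ _ ha, orbitSum_const_smul c a⟩
    have hsub := hY.eq_zero_of_orbitSum_eq_zero ξ hξinv (f - ⟨f', hML hf'⟩) (by
      change orbitSum G ((f : X → k) - f') = 0
      rw [sub_eq_add_neg, ← neg_one_smul k f', orbitSum_add, orbitSum_const_smul, hff',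
        neg_one_smul, add_neg_cancel])
    rw [map_sub, sub_eq_zero] at hsub
    rw [hsub]
    exact (Submodule.mem_dualAnnihilator _).1 hξ _ hf'

end ModularStrata

/-! ### Strata when the order of `G` is invertible in `k`. -/

/-- An infinite representation `L` in coprime characteristic that is generated by images of a finite
representation `P` is a direct sum of copies of `P`, provided that each nonzero vector of `P` has at
least `#L` images in `L`. -/
theorem Representation.exists_finsupp_equiv {k G P L : Type*} [Field k] [Group G] [Finite G]
    [NeZero (Nat.card G : k)] [AddCommGroup P] [Module k P] [AddCommGroup L] [Module k L] [Finite P]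
    [Nontrivial P] [Infinite L] (ρ : Representation k G P) (σ : Representation k G L)
    (hspan : ∀ f : L, f ∈ Submodule.span k
      {x | ∃ θ : P →ₗ[k] L, (∀ g p, θ (ρ g p) = σ g (θ p)) ∧ ∃ p, θ p = x})
    (hcard : ∀ v : P, v ≠ 0 → ∃ F : L → P →ₗ[k] L,
      (∀ m g p, F m (ρ g p) = σ g (F m p)) ∧ Function.Injective fun m => F m v) :
    ∃ (S : Set (P → L)) (e : (S →₀ P) ≃ₗ[k] L),
      ∀ i g p, e (Finsupp.single i (ρ g p)) = σ g (e (Finsupp.single i p)) := by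
  let _ : Module (MonoidAlgebra k G) P := Module.compHom P ρ.asAlgebraHom.toRingHom
  let _ : Module (MonoidAlgebra k G) L := Module.compHom L σ.asAlgebraHom.toRingHom
  have hρ : ∀ (x : MonoidAlgebra k G) (v : P), x • v = ρ.asAlgebraHom x v := fun _ _ => rfl
  have hσ : ∀ (x : MonoidAlgebra k G) (v : L), x • v = σ.asAlgebraHom x v := fun _ _ => rfl
  have hρ1 : ∀ g v, MonoidAlgebra.single g (1 : k) • v = ρ g v := fun g v => by simp [hρ]
  have hσ1 : ∀ g v, MonoidAlgebra.single g (1 : k) • v = σ g v := fun g v => by simp [hσ]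
  have : IsScalarTower k (MonoidAlgebra k G) P :=
    ⟨fun c x v => by rw [hρ, hρ, map_smul, LinearMap.smul_apply]⟩
  have : IsScalarTower k (MonoidAlgebra k G) L :=
    ⟨fun c x v => by rw [hσ, hσ, map_smul, LinearMap.smul_apply]⟩
  have hhom : ∀ θ : P →ₗ[k] L, (∀ g p, θ (ρ g p) = σ g (θ p)) →
      ∃ θ' : P →ₗ[MonoidAlgebra k G] L, ∀ p, θ' p = θ p := fun θ hθ =>
    ⟨MonoidAlgebra.equivariantOfLinearOfComm θ fun g p => by rw [hρ1, hσ1, hθ], fun _ => rfl⟩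
  obtain ⟨S, ⟨e⟩⟩ := IsSemisimpleModule.exists_linearEquiv_finsupp (A := MonoidAlgebra k G)
    (P := P) (L := L)
    (by
      rw [eq_top_iff]
      intro f _
      suffices h : Submodule.span k
          {x | ∃ θ : P →ₗ[k] L, (∀ g p, θ (ρ g p) = σ g (θ p)) ∧ ∃ p, θ p = x} ≤
          (⨆ θ : P →ₗ[MonoidAlgebra k G] L, LinearMap.range θ).restrictScalars k from h (hspan f)
      refine Submodule.span_le.2 ?_
      rintro _ ⟨θ, hθ, p, rfl⟩
      obtain ⟨θ', hθ'⟩ := hhom θ hθ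
      exact Submodule.mem_iSup_of_mem θ' ⟨p, hθ' p⟩)
    (by
      intro V hV
      have := IsSimpleModule.nontrivial (MonoidAlgebra k G) V
      obtain ⟨v, hv⟩ := exists_ne (0 : V)
      obtain ⟨F, hF, hFi⟩ := hcard v fun h => hv (Subtype.ext h)
      choose F' hF' using fun m => hhom (F m) (hF m)
      refine ⟨fun m => F' m ∘ₗ V.subtype, fun m m' h => hFi ?_⟩
      have h' : F' m v = F' m' v := LinearMap.congr_fun h v
      simpa [hF'] using h')
  -- The index set is transported to plain functions, since the conclusion cannot mention the local
  -- group-algebra module structures.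
  let S' : Set (P → L) := (fun θ : P →ₗ[MonoidAlgebra k G] L => (θ : P → L)) '' S
  let E : S ≃ S' := Equiv.Set.image _ S DFunLike.coe_injective
  refine ⟨S', (Finsupp.domLCongr E.symm).trans (e.restrictScalars k), fun i g p => ?_⟩
  simp only [LinearEquiv.trans_apply, Finsupp.domLCongr_single, LinearEquiv.restrictScalars_apply]
  rw [← hρ1, ← Finsupp.smul_single, map_smul, hσ1]


section SemisimpleStrata

open MulAction

variable {G X : Type*} [Group G] [MulAction G X] [TopologicalSpace X] {H : Subgroup G} {Y : Set X}
  {k : Type*} [Field k]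

/-- An `H`-invariant function on `Y` defines a homomorphism from `k[G/H]`. -/
theorem exists_hom_of_invariant [ContinuousConstSMul G X] [Fintype (G ⧸ H)]
    (hY : ∀ (g : G), ∀ x ∈ Y, g • x ∈ Y) (m : lcOn k k Y)
    (hm : ∀ h ∈ H, ∀ x, (m : X → k) (h • x) = (m : X → k) x) :
    ∃ θ : (G ⧸ H → k) →ₗ[k] lcOn k k Y,
      (∀ g c, θ (funRep k G (G ⧸ H) g c) = lcRep hY g (θ c)) ∧
      ∀ c : G ⧸ H → k, θ c = ∑ q : G ⧸ H, c q • lcRep hY q.out m := by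
  let θ₀ : (G ⧸ H → k) →ₗ[k] lcOn k k Y :=
    ∑ q : G ⧸ H, LinearMap.toSpanSingleton k _ (lcRep hY q.out m) ∘ₗ LinearMap.proj q
  have hθ₀ : ∀ c, θ₀ c = ∑ q : G ⧸ H, c q • lcRep hY q.out m := fun c => by
    simp [θ₀, LinearMap.sum_apply]
  refine ⟨θ₀, fun g c => ?_, hθ₀⟩
  rw [hθ₀, hθ₀, map_sum, ← Equiv.sum_comp (MulAction.toPerm g)]
  refine Finset.sum_congr rfl fun q _ => ?_
  rw [map_smul]
  have : lcRep hY g (lcRep hY q.out m) = lcRep hY (g • q).out m :=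
    Subtype.ext (funRep_funRep_out hm g q)
  rw [this]
  simp

variable [Finite G] [ContinuousConstSMul G X] [CompactSpace X] [T2Space X]
  [TotallyDisconnectedSpace X]

/-- A function is determined by the saturation of its support together with, for each `g` and `c`,
the orbits through those `t` in the transversal where `f (g • t) = c`. These are finitely many
invariant clopens, and an infinite set absorbs a finite power of itself. -/
theorem IsStratum.exists_injective_invClopens [Finite k] (hY : IsStratum H Y)
    [Infinite (lcOn k k Y)] : ∃ f : lcOn k k Y → invClopens G Y, f.Injective := by
  choose T hT using fun K : invClopens G Y => hY.exists_isTransversal K.2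
  let sat : lcOn k k Y → invClopens G Y := fun f =>
    ⟨_, orbitUnion_support_mem_invClopens hY.smul_mem f.2⟩
  let D : lcOn k k Y → G × k → invClopens G Y := fun f a =>
    ⟨orbitUnion G (T (sat f) ∩ (fun x => (f : X → k) (a.1 • x)) ⁻¹' {a.2}),
      isClopen_orbitUnion ((hT (sat f)).isClopen.inter
        ((f.2.1.comp_continuous (continuous_const_smul a.1)).isClopen_fiber a.2)),
      by
        rintro x ⟨g, hg, -⟩
        simpa using hY.smul_mem g⁻¹ _ ((sat f).2.2.1 ((hT (sat f)).subset hg)),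
      fun g x hx => smul_mem_orbitUnion g hx⟩
  have hinj : Function.Injective fun f => (sat f, D f) := by
    intro f f' h
    have h1 : sat f = sat f' := congrArg Prod.fst h
    have h2 : D f = D f' := congrArg Prod.snd h
    apply Subtype.ext
    ext x
    by_cases hx : x ∈ (sat f : Set X)
    · obtain ⟨q, t, ht, rfl⟩ := (hT (sat f)).exists_eq_smul hx
      have hmem : t ∈ (D f (q.out, (f : X → k) (q.out • t)) : Set X) :=
        subset_orbitUnion _ ⟨ht, rfl⟩
      rw [h2] at hmem
      obtain ⟨g, hg, hg'⟩ := hmem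
      rw [← h1] at hg
      rw [(hT (sat f)).smul_eq ht ((hT (sat f)).mem_of_smul_mem g t ht hg)] at hg'
      exact hg'.symm
    · rw [eq_zero_of_notMem_orbitUnion_support (G := G) hx,
        eq_zero_of_notMem_orbitUnion_support (G := G) (f := (f' : X → k))]
      rw [h1] at hx
      exact hx
  have hinf : Infinite (invClopens G Y) := by
    by_contra hfin
    rw [not_infinite_iff_finite] at hfin
    exact not_finite_iff_infinite.2 ‹Infinite (lcOn k k Y)› (Finite.of_injective _ hinj)
  obtain ⟨a1⟩ := nonempty_embedding_of_finite_pi (V := Option (G × k)) (Y := invClopens G Y)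
  refine ⟨fun f => a1 fun o => o.elim (sat f) (D f), fun f f' h => hinj (Prod.ext ?_ ?_)⟩
  · exact congrFun (a1.injective h) none
  · exact funext fun a => congrFun (a1.injective h) (some a)

/-- Distinct invariant clopens have distinct indicators, so there are finitely many, and they cover
`Y`. -/
theorem IsStratum.mem_invClopens_of_finite [Finite (lcOn k k Y)] (hY : IsStratum H Y) :
    Y ∈ invClopens G Y := by
  have hfin : (invClopens G Y).Finite := by
    refine Set.Finite.of_injOn (f := fun K => K.indicator (1 : X → k))
      (t := (lcOn k k Y : Set (X → k))) ?_ ?_ (Set.toFinite _)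
    · intro K hK
      exact indicator_mem_lcOn (IsLocallyConstant.const 1) hK.1 hK.2.1
    · intro K _ K' _ h
      ext x
      have := congrFun h x
      by_cases hx : x ∈ K <;> by_cases hx' : x ∈ K' <;> simp_all
  have hunion : Y = ⋃₀ invClopens G Y := by
    refine subset_antisymm (fun x hx => ?_) (Set.sUnion_subset fun K hK => hK.2.1)
    obtain ⟨D, hD, hxD, hDY⟩ := compact_exists_isClopen_in_isOpen hY.isOpen hx
    refine ⟨orbitUnion G D, ⟨isClopen_orbitUnion hD, ?_, fun g x hx => smul_mem_orbitUnion g hx⟩,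
      subset_orbitUnion D hxD⟩
    rintro y ⟨g, hg⟩
    simpa using hY.smul_mem g⁻¹ _ (hDY hg)
  refine ⟨?_, subset_rfl, hY.smul_mem⟩
  rw [hunion, Set.sUnion_eq_biUnion]
  exact hfin.isClopen_biUnion fun K hK => hK.1

/-- If the order of `G` is invertible in `k`, the functions on a stratum have a permutation basis. -/
theorem IsStratum.hasPermBasis_of_neZero [Finite k] [NeZero (Nat.card G : k)]
    (hY : IsStratum H Y) : HasPermBasis G (lcOn k k Y) := by
  classical
  rcases finite_or_infinite (lcOn k k Y) with hfin | hinf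
  · have hYY := hY.mem_invClopens_of_finite (k := k)
    obtain ⟨T, hT⟩ := hY.exists_isTransversal hYY
    exact hT.hasPermBasis hYY
  have := Fintype.ofFinite (G ⧸ H)
  let ρ := funRep k G (G ⧸ H)
  let σ := lcRep (k := k) hY.smul_mem
  have hspan : ∀ f : lcOn k k Y, f ∈ Submodule.span k {x | ∃ θ : (G ⧸ H → k) →ₗ[k] lcOn k k Y,
      (∀ g p, θ (ρ g p) = σ g (θ p)) ∧ ∃ p, θ p = x} := by
    intro f
    have hK := orbitUnion_support_mem_invClopens hY.smul_mem f.2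
    obtain ⟨T, hT⟩ := hY.exists_isTransversal hK
    let c : G ⧸ H → lcOn k k Y := fun q => ⟨T.indicator fun x => (f : X → k) (q.out • x),
      indicator_mem_lcOn (f.2.1.comp_continuous (continuous_const_smul q.out)) hT.isClopen
        (hT.subset.trans hK.2.1)⟩
    have hcinv : ∀ q, ∀ h ∈ H, ∀ x, (c q : X → k) (h • x) = (c q : X → k) x := fun q =>
      hT.invariant_of_eq_zero fun x hx =>
        Set.indicator_of_notMem (f := fun x => (f : X → k) (q.out • x)) hx
    have h1 : f = ∑ q, σ q.out (c q) := by
      apply Subtype.ext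
      rw [AddSubmonoidClass.coe_finsetSum]
      exact hT.eq_sum_funRep_indicator hK fun x hx => eq_zero_of_notMem_orbitUnion_support hx
    rw [h1]
    refine Submodule.sum_mem _ fun q _ => Submodule.subset_span ?_
    obtain ⟨θ, hθ, hθ'⟩ := exists_hom_of_invariant hY.smul_mem (c q) (hcinv q)
    refine ⟨θ, hθ, Pi.single q 1, ?_⟩
    rw [hθ', Finset.sum_eq_single q]
    · rw [Pi.single_eq_same, one_smul]
    · intro q' _ hq'
      rw [Pi.single_eq_of_ne hq', zero_smul]
    · simp
  have hcard : ∀ v : G ⧸ H → k, v ≠ 0 → ∃ F : lcOn k k Y → (G ⧸ H → k) →ₗ[k] lcOn k k Y,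
      (∀ m g p, F m (ρ g p) = σ g (F m p)) ∧ Function.Injective fun m => F m v := by
    intro v hv
    obtain ⟨f, hf⟩ := hY.exists_injective_invClopens (k := k)
    choose T hT using fun K : invClopens G Y => hY.exists_isTransversal K.2
    choose θ hθ hθ' using fun K : invClopens G Y => exists_hom_of_invariant (k := k) hY.smul_mem
      ⟨_, indicator_mem_lcOn (f := 1) (IsLocallyConstant.const 1) (hT K).isClopen
        ((hT K).subset.trans K.2.2.1)⟩
      ((hT K).invariant_of_eq_zero fun x hx => Set.indicator_of_notMem hx _)
    -- The map `θ K` sends the trivial coset to the indicator of a transversal of `K`. Since `v ≠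
    -- 0`, `K` is recovered from `θ K v` as the saturation of its support, which gives injectivity.
    refine ⟨fun m => θ (f m), fun m => hθ _, Function.Injective.comp (g := fun K => θ K v) ?_ hf⟩
    obtain ⟨q₀, hq₀⟩ : ∃ q, v q ≠ 0 := by
      by_contra! hcon
      exact hv (funext hcon)
    have hval : ∀ K x, (θ K v).1 x =
        ∑ q : G ⧸ H, v q • (T K).indicator (1 : X → k) (q.out⁻¹ • x) := by
      intro K x
      have := congrArg Subtype.val (hθ' K v)
      rw [this, AddSubmonoidClass.coe_finsetSum, Finset.sum_apply]
      rfl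
    have hrec : ∀ K : invClopens G Y, K.1 = orbitUnion G (Function.support (θ K v).1) := by
      intro K
      ext x
      constructor
      · intro hx
        obtain ⟨g, hg⟩ := (hT K).exists_smul_mem x hx
        refine ⟨q₀.out * g, ?_⟩
        rw [Function.mem_support, hval, mul_smul,
          (hT K).sum_inv_smul (fun q x => v q • (T K).indicator (1 : X → k) x)
            (fun q x hx => by rw [Set.indicator_of_notMem hx, smul_zero]) hg q₀,
          Set.indicator_of_mem hg]
        simpa using hq₀
      · rintro ⟨g, hg⟩
        by_contra hx
        have hgx : g • x ∉ K.1 := fun h => hx (by simpa using K.2.2.2 g⁻¹ _ h)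
        refine hg ?_
        rw [hval]
        refine Finset.sum_eq_zero fun q _ => ?_
        rw [Set.indicator_of_notMem ((hT K).inv_smul_notMem K.2 hgx _), smul_zero]
    intro K K' h
    apply Subtype.ext
    rw [hrec K, hrec K']
    exact congrArg (fun f : lcOn k k Y => orbitUnion G (Function.support f.1)) h
  obtain ⟨S, e, he⟩ := ρ.exists_finsupp_equiv σ hspan hcard
  let b' : Module.Basis (Σ _ : S, G ⧸ H) k (lcOn k k Y) :=
    (Finsupp.basis (φ := fun _ => G ⧸ H) fun _ => Pi.basisFun k (G ⧸ H)).map e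
  have hb' : ∀ i q, b' ⟨i, q⟩ = e (Finsupp.single i (Pi.single q (1 : k))) := by
    intro i q
    simp [b']
  have hsmul : ∀ i (g : G) (q : G ⧸ H), lcRep hY.smul_mem g (b' ⟨i, q⟩) = b' ⟨i, g • q⟩ := by
    intro i g q
    rw [hb', hb', ← he]
    congr 2
    funext q'
    simp [ρ, Pi.single_apply, inv_smul_eq_iff]
  have hout : ∀ i (q : G ⧸ H), lcRep hY.smul_mem q.out (b' ⟨i, ((1 : G) : G ⧸ H)⟩) = b' ⟨i, q⟩ := by
    intro i q
    rw [hsmul]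
    congr 2
    conv_rhs => rw [← QuotientGroup.out_eq' q]
    change ((q.out * 1 : G) : G ⧸ H) = _
    rw [mul_one]
  have hfam : (fun t : Σ _ : S, G ⧸ H => funRep k G X t.2.out
      (b' ⟨t.1, ((1 : G) : G ⧸ H)⟩ : lcOn k k Y).1) = (lcOn k k Y).subtype ∘ b' := by
    funext ⟨i, q⟩
    exact congrArg Subtype.val (hout i q)
  refine IsPermFamily.hasPermBasis (s := fun _ : S => H)
    (φ := fun i => (b' ⟨i, ((1 : G) : G ⧸ H)⟩ : lcOn k k Y).1) ⟨fun i h hh x => ?_, ?_, ?_⟩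
  · have h1 := congrArg Subtype.val (hsmul i h⁻¹ ((1 : G) : G ⧸ H))
    have h2 : h⁻¹ • ((1 : G) : G ⧸ H) = ((1 : G) : G ⧸ H) := by
      change ((h⁻¹ * 1 : G) : G ⧸ H) = _
      rw [QuotientGroup.eq]
      simpa using hh
    rw [h2] at h1
    have := congrFun h1 x
    rw [coe_lcRep, funRep_apply, inv_inv] at this
    exact this
  · rw [hfam]
    exact b'.linearIndependent.map' (lcOn k k Y).subtype (by simp)
  · rw [hfam, Set.range_comp, ← Submodule.map_span]
    have : Submodule.span k (Set.range b') = (⊤ : Submodule k (lcOn k k Y)) := b'.span_eq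
    rw [this, Submodule.map_top, Submodule.range_subtype]

end SemisimpleStrata

/-! ### Combining permuted bases along a restriction map. -/

section Extension

variable {k G X Z : Type*} [Field k] [Group G] [MulAction G X] [MulAction G Z]

/-- A permutation basis of a quotient with invariant lifts and one of the kernel combine to a
permutation basis. -/
theorem IsPermFamily.sum_elim {L N : Submodule k (X → k)} {M : Submodule k (Z → k)}
    (r : (X → k) →ₗ[k] (Z → k)) (hr : ∀ g f, r (funRep k G X g f) = funRep k G Z g (r f))
    (hL : ∀ g, ∀ f ∈ L, funRep k G X g f ∈ L) (hNL : N ≤ L) (hN : ∀ f ∈ L, f ∈ N ↔ r f = 0)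
    (hLM : ∀ f ∈ L, r f ∈ M) {ι ι' : Type*} {s : ι → Subgroup G} {φ : ι → X → k}
    {s' : ι' → Subgroup G} {ψ : ι' → Z → k} (hφ : IsPermFamily N s φ) (hψ : IsPermFamily M s' ψ)
    (φ' : ι' → X → k) (hφ'L : ∀ i, φ' i ∈ L) (hφ'r : ∀ i, r (φ' i) = ψ i)
    (hφ'inv : ∀ i, ∀ h ∈ s' i, ∀ x, φ' i (h • x) = φ' i x) :
    IsPermFamily L (Sum.elim s s') (Sum.elim φ φ') := by
  set u : (Σ i, G ⧸ s i) → X → k := fun t => funRep k G X t.2.out (φ t.1)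
  set v : (Σ i, G ⧸ s' i) → X → k := fun t => funRep k G X t.2.out (φ' t.1) with hv
  have hrv : r ∘ v = fun t => funRep k G Z t.2.out (ψ t.1) := by
    funext t
    simp only [Function.comp_apply, hv, hr, hφ'r]
  let E : (Σ i : ι ⊕ ι', G ⧸ Sum.elim s s' i) ≃ (Σ i, G ⧸ s i) ⊕ (Σ i, G ⧸ s' i) :=
    Equiv.sumSigmaDistrib fun i => G ⧸ Sum.elim s s' i
  have hfam : (fun t : Σ i : ι ⊕ ι', G ⧸ Sum.elim s s' i =>
      funRep k G X t.2.out (Sum.elim φ φ' t.1)) = Sum.elim u v ∘ E := by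
    funext t
    rcases t with ⟨i | i, q⟩ <;> rfl
  have hlirv : LinearIndependent k (r ∘ v) := hrv ▸ hψ.linearIndependent
  have huN : Submodule.span k (Set.range u) = N := hφ.span_eq
  refine ⟨?_, ?_, ?_⟩
  · rintro (i | i)
    exacts [hφ.invariant i, hφ'inv i]
  · rw [hfam]
    refine (hφ.linearIndependent.sum_type hlirv.of_comp ?_).comp _ E.injective
    change Disjoint (Submodule.span k (Set.range u)) _
    rw [huN, Submodule.disjoint_def]
    intro x hx hxv
    obtain ⟨c, rfl⟩ := (Finsupp.mem_span_range_iff_exists_finsupp).1 hxv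
    have h0 := (hN _ (hNL hx)).1 hx
    rw [map_finsuppSum] at h0
    simp only [map_smul] at h0
    have hc : c = 0 := linearIndependent_iff.1 hlirv c h0
    simp [hc]
  · rw [hfam, E.surjective.range_comp, Set.Sum.elim_range, Submodule.span_union, huN]
    have hvL : Submodule.span k (Set.range v) ≤ L := Submodule.span_le.2 (by
      rintro _ ⟨t, rfl⟩
      exact hL _ _ (hφ'L _))
    refine le_antisymm (sup_le hNL hvL) fun f hf => ?_
    have hmem : r f ∈ (Submodule.span k (Set.range v)).map r := by
      rw [Submodule.map_span, ← Set.range_comp, hrv, hψ.span_eq]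
      exact hLM f hf
    obtain ⟨f', hf', hff'⟩ := hmem
    rw [← sub_add_cancel f f']
    refine add_mem (Submodule.mem_sup_left ?_) (Submodule.mem_sup_right hf')
    rw [hN _ (sub_mem hf (hvL hf')), map_sub, hff', sub_self]

end Extension

/-! ### Induction over the stabilizers of a pointed profinite space. -/

section Pointed

open MulAction

variable {G : Type*} [Group G] [Finite G] {k : Type*} [Field k] [Finite k]

/-- Invariant locally constant functions extend from closed subsets to invariant locally constant
functions. -/
theorem exists_invariant_extension {X : Type*} [TopologicalSpace X] [CompactSpace X] [T2Space X]
    [TotallyDisconnectedSpace X] [MulAction G X] [ContinuousConstSMul G X] {Z : Set X}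
    (hZ : IsClosed Z) (hZG : ∀ (g : G), ∀ x ∈ Z, g • x ∈ Z) {x₀ : X} (hx₀ : x₀ ∈ Z)
    (K : Subgroup G) (f : X → k) (hf : IsLocallyConstant fun z : Z => f z) (hf0 : f x₀ = 0)
    (hfK : ∀ h ∈ K, ∀ z ∈ Z, f (h • z) = f z) :
    ∃ F ∈ lcOn k k ({x₀}ᶜ : Set X), (∀ z ∈ Z, F z = f z) ∧ ∀ h ∈ K, ∀ x, F (h • x) = F x := by
  classical
  have := Fintype.ofFinite k
  have hsep : ∀ c : k, ∃ C : Set X, IsClopen C ∧ ∀ z ∈ Z, z ∈ C ↔ f z = c := by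
    intro c
    have hc := hf.isClopen_fiber c
    have hA : IsClosed (((↑) : Z → X) '' {z : Z | f z = c}) :=
      hZ.isClosedEmbedding_subtypeVal.isClosedMap _ hc.isClosed
    have hB : IsClosed (((↑) : Z → X) '' {z : Z | f z = c}ᶜ) :=
      hZ.isClosedEmbedding_subtypeVal.isClosedMap _ hc.compl.isClosed
    obtain ⟨C, hC, hAC, hCB⟩ := exists_clopen_of_closed_subset_open hA hB.isOpen_compl (by
      rintro _ ⟨z, hz, rfl⟩ ⟨z', hz', h⟩
      rw [Subtype.ext h] at hz'
      exact hz' hz)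
    refine ⟨C, hC, fun z hz => ⟨fun hzC => ?_, fun h => hAC ⟨⟨z, hz⟩, h, rfl⟩⟩⟩
    by_contra hne
    exact hCB hzC ⟨⟨z, hz⟩, hne, rfl⟩
  choose C hC hCf using hsep
  -- Intersecting over `K` makes the separating clopens `K`-invariant. Their traces on `Z` do not
  -- change, since these are already `K`-invariant.
  let D : k → Set X := fun c => ⋂ h : K, ((h : G) • ·) ⁻¹' C c
  have hD : ∀ c, IsClopen (D c) := fun c =>
    isClopen_iInter_of_finite fun h => (hC c).preimage (continuous_const_smul (h : G))
  have hDf : ∀ c, ∀ z ∈ Z, z ∈ D c ↔ f z = c := by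
    intro c z hz
    refine Set.mem_iInter.trans ⟨fun h => ?_, fun h a => ?_⟩
    · have := h 1
      rw [Set.mem_preimage, Subgroup.coe_one, one_smul] at this
      exact (hCf c z hz).1 this
    · refine (hCf c _ (hZG _ z hz)).2 ?_
      rw [hfK _ a.2 z hz, h]
  have hDinv : ∀ c, ∀ h ∈ K, ∀ x, x ∈ D c → h • x ∈ D c := by
    intro c h hh x hx
    refine Set.mem_iInter.2 fun a => ?_
    have := Set.mem_iInter.1 hx (a * ⟨h, hh⟩)
    rw [Set.mem_preimage, ← mul_smul]
    exact this
  have hval : ∀ z ∈ Z, (∑ c : k, (D c).indicator (fun _ => c)) z = f z := by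
    intro z hz
    rw [Finset.sum_apply, Finset.sum_eq_single (f z)]
    · exact Set.indicator_of_mem ((hDf _ z hz).2 rfl) _
    · intro c _ hc
      exact Set.indicator_of_notMem (fun h => hc ((hDf _ z hz).1 h).symm) _
    · simp
  refine ⟨∑ c : k, (D c).indicator fun _ => c, ⟨?_, ?_⟩, hval, ?_⟩
  · exact (Submodule.sum_mem (lcOn k k Set.univ) fun c _ =>
      indicator_mem_lcOn (IsLocallyConstant.const c) (hD c) (Set.subset_univ _) :
        (∑ c : k, (D c).indicator fun _ => c) ∈ lcOn k k Set.univ).1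
  · intro x hx
    rw [Set.mem_compl_singleton_iff, not_not] at hx
    rw [hx, hval x₀ hx₀, hf0]
  · intro h hh x
    simp only [Finset.sum_apply]
    refine Finset.sum_congr rfl fun c _ => ?_
    have hiff : h • x ∈ D c ↔ x ∈ D c := by
      refine ⟨fun hx => ?_, hDinv c h hh x⟩
      simpa using hDinv c h⁻¹ (inv_mem hh) _ hx
    simp only [Set.indicator_apply, hiff]

/-- The locally constant functions vanishing at the base point of a pointed profinite space with an
action of a finite `p`-group have a permutation basis. -/
theorem IsPGroup.hasPermBasis {p : ℕ} [Fact p.Prime] (hG : IsPGroup p G) (n : ℕ) :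
    ∀ (X : Type*) [TopologicalSpace X] [CompactSpace X] [T2Space X]
    [TotallyDisconnectedSpace X] [MulAction G X] [ContinuousConstSMul G X] (x₀ : X)
    (_ : ∀ g : G, g • x₀ = x₀) (_ : (stabilizer G '' ({x₀}ᶜ : Set X)).ncard = n),
    HasPermBasis G (lcOn k k ({x₀}ᶜ : Set X)) := by
  induction n using Nat.strong_induction_on with
  | _ n ih =>
  intro X _ _ _ _ _ _ x₀ hx₀ hn
  have : Finite (Subgroup G) := Finite.of_injective _ SetLike.coe_injective
  set St := stabilizer G '' ({x₀}ᶜ : Set X)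
  have hStfin : St.Finite := Set.toFinite _
  have hne : ∀ (g : G) (x : X), x ≠ x₀ → g • x ≠ x₀ := by
    intro g x hx h
    refine hx ?_
    rw [← inv_smul_smul g x, h, hx₀]
  rcases St.eq_empty_or_nonempty with hemp | hnon
  · have hbot : lcOn k k ({x₀}ᶜ : Set X) = ⊥ := by
      rw [Set.image_eq_empty] at hemp
      rw [eq_bot_iff]
      intro f hf
      rw [Submodule.mem_bot]
      ext x
      exact hf.2 x (by simp [hemp])
    rw [hbot]
    exact IsPermFamily.hasPermBasis (ι := Empty) (s := fun i => i.elim) (φ := fun i => i.elim)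
      ⟨fun i => i.elim, linearIndependent_empty_type, by simp⟩
  -- Stabilizers can only shrink near a point, so least order makes them locally constant on `Y`;
  -- this is why `Y` is open.
  obtain ⟨H, hH, hmin⟩ := St.exists_min_image (fun K : Subgroup G => Nat.card K) hStfin hnon
  let Y : Set X := {x | x ≠ x₀ ∧ ∃ g : G, stabilizer G (g • x) = H}
  have hYs : IsStratum H Y := by
    refine ⟨?_, ?_, fun x hx => hx.2⟩
    · rw [isOpen_iff_mem_nhds]
      rintro x ⟨hx, g, hg⟩
      have hev : ∀ a : G, ∀ᶠ y in nhds x, a ∉ H → a • g • y ≠ g • y := by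
        intro a
        by_cases ha : a ∈ H
        · exact Filter.Eventually.of_forall fun y h => absurd ha h
        · have hax : a • g • x ≠ g • x := fun h => ha (hg ▸ mem_stabilizer_iff.2 h)
          have hc1 : Continuous fun y : X => a • g • y :=
            (continuous_const_smul a).comp (continuous_const_smul g)
          filter_upwards [(isOpen_ne_fun hc1 (continuous_const_smul g)).mem_nhds hax] with y hy _
          exact hy
      filter_upwards [isOpen_compl_singleton.mem_nhds hx, Filter.eventually_all.2 hev] with y hy hyg
      refine ⟨hy, g, ?_⟩
      have hle : stabilizer G (g • y) ≤ H := by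
        intro a ha
        by_contra haH
        exact hyg a haH ha
      refine SetLike.coe_injective (Set.eq_of_subset_of_ncard_le hle ?_ (Set.toFinite _))
      exact hmin _ ⟨g • y, hne g y hy, rfl⟩
    · rintro g x ⟨hx, a, ha⟩
      exact ⟨hne g x hx, a * g⁻¹, by simpa [mul_smul] using ha⟩
  have hYbasis : HasPermBasis G (lcOn k k Y) := by
    by_cases hk : (p : k) = 0
    · exact hYs.hasPermBasis_of_isPGroup hG hk
    · have : NeZero (Nat.card G : k) := by
        obtain ⟨m, hm⟩ := IsPGroup.iff_card.1 hG
        refine ⟨?_⟩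
        rw [hm, Nat.cast_pow]
        exact pow_ne_zero m hk
      exact hYs.hasPermBasis_of_neZero
  have hYc : ∀ (g : G), ∀ x ∈ Yᶜ, g • x ∈ Yᶜ := by
    intro g x hx h
    exact hx (by simpa using hYs.smul_mem g⁻¹ _ h)
  let Z : SubMulAction G X := ⟨Yᶜ, fun g x hx => hYc g x hx⟩
  have hZcl : IsClosed (Z : Set X) := hYs.isOpen.isClosed_compl
  have : CompactSpace Z := isCompact_iff_compactSpace.1 hZcl.isCompact
  have : ContinuousConstSMul G Z :=
    ⟨fun g => ((continuous_const_smul g).comp continuous_subtype_val).subtype_mk _⟩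
  have hx₀Z : x₀ ∈ Z := fun h => h.1 rfl
  let z₀ : Z := ⟨x₀, hx₀Z⟩
  -- `H` no longer occurs as a stabilizer on the complement of `Y`.
  have hlt : (stabilizer G '' ({z₀}ᶜ : Set Z)).ncard < n := by
    rw [← hn]
    refine Set.ncard_lt_ncard ⟨?_, fun hsub => ?_⟩ hStfin
    · rintro _ ⟨z, hz, rfl⟩
      exact ⟨z, fun h => hz (Subtype.ext h), (SubMulAction.stabilizer_of_subMul z).symm⟩
    · obtain ⟨z, hz, hzH⟩ := hsub hH
      refine z.2 ⟨fun h => hz (Subtype.ext h), 1, ?_⟩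
      rw [one_smul, ← SubMulAction.stabilizer_of_subMul, hzH]
  obtain ⟨I, s', hψ⟩ := ih _ hlt Z z₀ (fun g => Subtype.ext (hx₀ g)) rfl
  obtain ⟨J, s, hφ⟩ := hYbasis
  have hext : ∀ i : I, ∃ F ∈ lcOn k k ({x₀}ᶜ : Set X), (∀ z : Z, F z = (i : Z → k) z) ∧
      ∀ h ∈ s' i, ∀ x, F (h • x) = F x := by
    intro i
    classical
    have hi : (i : Z → k) ∈ lcOn k k ({z₀}ᶜ : Set Z) := by
      rw [← hψ.span_eq]
      refine Submodule.subset_span ⟨⟨i, ((1 : G) : G ⧸ s' i)⟩, ?_⟩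
      simp only [funRep_out (hψ.invariant i), map_one]
      rfl
    let f : X → k := fun x => if h : x ∈ Z then (i : Z → k) ⟨x, h⟩ else 0
    have hfz : ∀ z : Z, f z = (i : Z → k) z := fun z => by simp [f]
    obtain ⟨F, hF, hFf, hFK⟩ := exists_invariant_extension hZcl hYc hx₀Z (s' i) f
      (by simpa only [hfz] using hi.1) ((hfz z₀).trans (hi.2 z₀ (by simp)))
      (fun h hh z hz => by
        rw [hfz ⟨z, hz⟩, ← hψ.invariant i h hh ⟨z, hz⟩]
        exact hfz (h • ⟨z, hz⟩))
    exact ⟨F, hF, fun z => (hFf z z.2).trans (hfz z), hFK⟩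
  choose F hF hFr hFK using hext
  refine (IsPermFamily.sum_elim (LinearMap.funLeft k k ((↑) : Z → X)) (fun g f => rfl)
    (fun g f hf => funRep_mem_lcOn (fun g x hx => hne g x hx) g hf) ?_ ?_ ?_ hφ hψ F hF
    (fun i => funext (hFr i)) hFK).hasPermBasis
  · exact fun f hf => ⟨hf.1, fun x hx => hf.2 x fun h => hx h.1⟩
  · refine fun f hf => ⟨fun h => funext fun z => h.2 z z.2, fun h => ⟨hf.1, fun x hx => ?_⟩⟩
    exact congrFun h ⟨x, hx⟩
  · refine fun f hf => ⟨hf.1.comp_continuous continuous_subtype_val, fun z hz => hf.2 z fun h => ?_⟩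
    refine hz fun h' => h ?_
    rw [h']

end Pointed

/-! ### Lifting the permuted basis to coordinates on `U`. -/

open IsLocalRing in
theorem corollary2p3 (p : ℕ) [Fact p.Prime]
    {G : Type*} [Group G] [Finite G] (hG : IsPGroup p G)
    {R : Type u} [CommRing R] [TopologicalSpace R] [IsTopologicalRing R]
    [CompactSpace R] [T2Space R] [TotallyDisconnectedSpace R]
    [IsLocalRing R] [IsNoetherianRing R]
    {U : Type v} [AddCommGroup U] [Module R U] [TopologicalSpace U]
    [IsTopologicalAddGroup U] [ContinuousSMul R U]
    [CompactSpace U] [T2Space U] [TotallyDisconnectedSpace U]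
    [DistribMulAction G U] [SMulCommClass G R U] [ContinuousConstSMul G U]
    (hU : IsProfinitePermutationLattice R G U) :
    ∃ (κ : Subgroup G → Type v)
      (e : U ≃L[R] (∀ H : Subgroup G, κ H → CyclicPermutationModule R H)),
      ∀ (g : G) (u : U), e (g • u) = g • e u := by
  obtain ⟨B, hB, hGB⟩ := hU
  have : Finite (ResidueField R) := finite_residueField
  have hGX : ∀ (g : G), ∀ x ∈ insert 0 B, g • x ∈ insert 0 B := by
    rintro g x (rfl | hx)
    · exact Or.inl (smul_zero g)
    · exact Or.inr (hGB g x hx)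
  let _ : MulAction G (insert 0 B : Set U) :=
    { smul := fun g x => ⟨g • x, hGX g x x.2⟩
      one_smul := fun x => Subtype.ext (one_smul G (x : U))
      mul_smul := fun g h x => Subtype.ext (mul_smul g h (x : U)) }
  have : ContinuousConstSMul G (insert 0 B : Set U) :=
    ⟨fun g => ((continuous_const_smul g).comp continuous_subtype_val).subtype_mk _⟩
  have : CompactSpace (insert 0 B : Set U) :=
    isCompact_iff_compactSpace.1 hB.isClosed_insert.isCompact
  let x₀ : (insert 0 B : Set U) := ⟨0, Set.mem_insert _ _⟩
  obtain ⟨I, s, hφ⟩ := hG.hasPermBasis (k := ResidueField R) _ (insert 0 B : Set U) x₀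
    (fun g => Subtype.ext (smul_zero g)) rfl
  have hIL : ∀ i : I, (i : (insert 0 B : Set U) → ResidueField R) ∈
      lcOn (ResidueField R) (ResidueField R) ({x₀}ᶜ : Set (insert 0 B : Set U)) := by
    intro i
    rw [← hφ.span_eq]
    refine Submodule.subset_span ⟨⟨i, ((1 : G) : G ⧸ s i)⟩, ?_⟩
    simp only [funRep_out (hφ.invariant i), map_one]
    rfl
  -- lift the basis to functionals
  obtain ⟨lift, hlift, hlift0⟩ : ∃ lift : ResidueField R → R,
      (∀ c, residue R (lift c) = c) ∧ lift 0 = 0 := by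
    classical
    choose l hl using residue_surjective (R := R)
    refine ⟨fun c => if c = 0 then 0 else l c, fun c => ?_, by simp⟩
    by_cases hc : c = 0
    · simp [hc]
    · simp [hc, hl]
  have hlc : ∀ i : I, IsLocallyConstant fun x : (insert 0 B : Set U) => lift (i.1 x) :=
    fun i => (hIL i).1.comp lift
  choose f hf using fun i : I => hB.exists_extension (fun x => lift (i.1 x)) (hlc i).continuous
    (by rw [(hIL i).2 _ (by simp [x₀]), hlift0])
  let act : G → U →L[R] U := fun g =>
    ⟨DistribSMul.toLinearMap R U g, continuous_const_smul g⟩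
  -- The lift is applied value by value, so it preserves invariance on `B`; uniqueness of extensions
  -- carries this over to `U`.
  have hfinv : ∀ i, ∀ h ∈ s i, ∀ u, f i (h • u) = f i u := by
    intro i h hh u
    have : (f i).comp (act h) = f i := hB.hom_ext fun b hb => by
      have h1 := hf i ⟨b, Set.mem_insert_of_mem _ hb⟩
      have h2 := hf i (h • ⟨b, Set.mem_insert_of_mem _ hb⟩)
      rw [hφ.invariant i h hh] at h2
      exact h2.trans h1.symm
    exact DFunLike.congr_fun this u
  let F : (Σ i : I, G ⧸ s i) → U →L[R] R := fun t => (f t.1).comp (act t.2.out⁻¹)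
  have hFX : ∀ t (x : (insert 0 B : Set U)), F t x = lift (t.1.1 (t.2.out⁻¹ • x)) :=
    fun t x => hf t.1 (t.2.out⁻¹ • x)
  have hres : (fun t (x : (insert 0 B : Set U)) => residue R (F t x)) =
      fun t => funRep (ResidueField R) G _ t.2.out t.1.1 := by
    funext t x
    rw [hFX, hlift, funRep_apply]
  have hbij : Function.Bijective fun u t => F t u := by
    refine hB.bijective_of_residue_basis F (fun t => ?_) ?_ ?_
    · simp only [hFX]
      exact (hlc t.1).comp_continuous (continuous_const_smul t.2.out⁻¹)
    · rw [hres]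
      exact hφ.linearIndependent
    · rw [hres, hφ.span_eq]
      refine fun g hg => ⟨hg.1, fun x hx => hg.2 x fun h => hx fun h' => h ?_⟩
      exact congrArg Subtype.val h'
  -- the coordinates, arranged by stabilizers
  have : Small.{v} (ResidueField R) := Countable.toSmall _
  obtain ⟨J, ⟨ε⟩⟩ : ∃ J : Type v, Nonempty (I ≃ J) := ⟨Shrink.{v} I, ⟨equivShrink I⟩⟩
  let κ : Subgroup G → Type v := fun H => {j : J // s (ε.symm j) = H}
  let E : U →ₗ[R] (∀ H : Subgroup G, κ H → CyclicPermutationModule R H) :=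
    { toFun := fun u H j q => f (ε.symm j.1) (q.out⁻¹ • u)
      map_add' := fun u u' => by
        funext H j q
        change f _ (_ • (u + u')) = f _ _ + f _ _
        rw [smul_add, map_add]
      map_smul' := fun c u => by
        funext H j q
        change f _ (_ • c • u) = c • f _ _
        rw [smul_comm, map_smul] }
  have hE : ∀ u H j q, E u H j q = f (ε.symm j.1) (q.out⁻¹ • u) :=
    fun _ _ _ _ => rfl
  have hEc : Continuous E := by
    refine continuous_pi fun H => continuous_pi fun j => ?_
    change Continuous fun u => (fun q : G ⧸ H => f (ε.symm j.1) (q.out⁻¹ • u))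
    exact continuous_pi fun q => (f _).continuous.comp (continuous_const_smul _)
  have hEi : Function.Injective E := by
    intro u u' h
    refine hbij.1 (funext fun ⟨i, q⟩ => ?_)
    have := congrFun (congrFun (congrFun h (s i)) ⟨ε i, congrArg s (ε.symm_apply_apply i)⟩) q
    rw [hE, hE] at this
    simpa using! this
  have hEs : Function.Surjective E := by
    intro y
    obtain ⟨u, hu⟩ := hbij.2 fun t => y (s t.1) ⟨ε t.1, congrArg s (ε.symm_apply_apply t.1)⟩ t.2
    refine ⟨u, ?_⟩
    funext H ⟨j, hj⟩ q
    subst hj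
    refine (congrFun hu ⟨ε.symm j, q⟩).trans ?_
    have : (⟨ε (ε.symm j), congrArg s (ε.symm_apply_apply _)⟩ : κ (s (ε.symm j))) =
      ⟨j, rfl⟩ := Subtype.ext (ε.apply_symm_apply j)
    exact congrFun (congrArg (y _) this) q
  have hT2 : ∀ H : Subgroup G, T2Space (CyclicPermutationModule R H) := fun H =>
    inferInstanceAs (T2Space (G ⧸ H → R))
  let E' := LinearEquiv.ofBijective E ⟨hEi, hEs⟩
  refine ⟨κ, ⟨E', hEc, ?_⟩, fun g u => ?_⟩
  · exact (Continuous.continuous_symm_of_equiv_compact_to_t2 (f := E'.toEquiv) hEc)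
  · funext H ⟨j, hj⟩ q
    subst hj
    change f _ (q.out⁻¹ • g • u) = f _ ((g⁻¹ • q).out⁻¹ • u)
    have hq : g⁻¹ • q = ((g⁻¹ * q.out : G) : G ⧸ s (ε.symm j)) := by
      conv_lhs => rw [← QuotientGroup.out_eq' q]
      rfl
    -- The two representatives of the coset differ by an element of the stabilizer, under which the
    -- functional is invariant.
    obtain ⟨h, hh⟩ := QuotientGroup.mk_out_eq_mul (s (ε.symm j)) (g⁻¹ * q.out)
    rw [hq, hh, mul_inv_rev, mul_smul, hfinv _ _ (inv_mem h.2)]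
    simp [mul_smul]
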